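/- Let $\mathcal X_1,\mathcal X_2,\mathcal Y_1,\mathcal Y_2$ be finite alphabets ($\mathcal X_1,\mathcal X_2$ non-empty) and let $p(y_1y_2|x_1x_2)$ be a discrete memoryless interference channel, i.e. $p(y_1^ny_2^n|x_1^nx_2^n)=\prod_{i=1}^n p(y_{1i}y_{2i}|x_{1i}x_{2i})$. Assume that it has one-sided weak interference: the marginal $p(y_2|x_1x_2)=\sum_{y_1}p(y_1y_2|x_1x_2)$ does not depend on $x_1$, so that it may be written $p(y_2|x_2)$, and $$p(y_1y_2|x_1x_2)=p(y_2|x_2)\,p'(y_1|x_1y_2)\qquad\text{for all }x_1,x_2,y_1,y_2$$ for some transition probabilities $p'(y_1|x_1y_2)$. A pair $(R_1,R_2)$ of nonnegative reals is achievable if for every $n$ there is a code of block length $n$ with message sets $\mathcal M_i$ of size $\lceil 2^{nR_i}\rceil$, encoders $f_i:\mathcal M_i\to\mathcal X_i^n$ and decoders $\varphi_i:\mathcal Y_i^n\to\mathcal M_i$ ($i=1,2$), such that for both $i=1,2$ the average error probability $$\lambda_i=\frac1{|\mathcal M_1||\mathcal M_2|}\sum_{w_1\in\mathcal M_1}\sum_{w_2\in\mathcal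 M_2}\Pr\{\varphi_i(Y_i^n)\ne w_i\mid W_1=w_1,W_2=w_2\}$$ tends to $0$ as $n\to\infty$. The capacity region is the closure of the set of achievable pairs, and the sum-rate capacity $C_{\mathrm{sum}}$ is the largest value of $R_1+R_2$ over the capacity region. Then this largest value exists, and $$C_{\mathrm{sum}}=\max_{p(x_1)p(x_2)}\{I(X_1;Y_1)+I(X_2;Y_2)\},$$ where the maximum, which is attained, is over all product distributions of the inputs $(X_1,X_2)$, $(Y_1,Y_2)$ is the output of one use of the channel with these inputs, and mutual informations are measured in bits. -/

import Mathlib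

open scoped BigOperators

noncomputable section

/-- A discrete memoryless interference channel with finite alphabets: the transition probabilities
`W.prob x₁ x₂ y₁ y₂ = p(y₁ y₂ | x₁ x₂)`. -/
structure DMIC (X₁ X₂ Y₁ Y₂ : Type*) [Fintype Y₁] [Fintype Y₂] where
  prob : X₁ → X₂ → Y₁ → Y₂ → ℝ
  prob_nonneg : ∀ x₁ x₂ y₁ y₂, 0 ≤ prob x₁ x₂ y₁ y₂
  prob_sum : ∀ x₁ x₂, ∑ y₁, ∑ y₂, prob x₁ x₂ y₁ y₂ = 1

/-- A code of block length `n` with `M₁` and `M₂` messages: two encoders, each seeing only its own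
message, and two decoders, each seeing only its own output sequence. -/
structure ICCode (X₁ X₂ Y₁ Y₂ : Type*) (n M₁ M₂ : ℕ) where
  enc₁ : Fin M₁ → (Fin n → X₁)
  enc₂ : Fin M₂ → (Fin n → X₂)
  dec₁ : (Fin n → Y₁) → Fin M₁
  dec₂ : (Fin n → Y₂) → Fin M₂

/-- The mutual information, in bits, of a pair of finite random variables with joint probability
mass function `p`: `∑ p(a,b) log₂ (p(a,b) / (p(a) p(b)))`, where terms with `p(a,b) = 0` vanish. -/
def mutualInfo {α β : Type*} [Fintype α] [Fintype β] (p : α → β → ℝ) : ℝ :=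
  ∑ a, ∑ b, p a b * Real.logb 2 (p a b / ((∑ b', p a b') * (∑ a', p a' b)))

namespace DMIC

variable {X₁ X₂ Y₁ Y₂ : Type*} [Fintype Y₁] [Fintype Y₂]

/-- `p(y₁ | x₁ x₂)`. -/
def marg₁ (W : DMIC X₁ X₂ Y₁ Y₂) (x₁ : X₁) (x₂ : X₂) (y₁ : Y₁) : ℝ :=
  ∑ y₂, W.prob x₁ x₂ y₁ y₂

/-- `p(y₂ | x₁ x₂)`. -/
def marg₂ (W : DMIC X₁ X₂ Y₁ Y₂) (x₁ : X₁) (x₂ : X₂) (y₂ : Y₂) : ℝ :=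
  ∑ y₁, W.prob x₁ x₂ y₁ y₂

/-- One-sided interference: `p(y₂ | x₁ x₂)` does not depend on `x₁`. -/
def OneSided (W : DMIC X₁ X₂ Y₁ Y₂) : Prop :=
  ∀ x₁ x₁' x₂ y₂, W.marg₂ x₁ x₂ y₂ = W.marg₂ x₁' x₂ y₂

/-- Weak one-sided interference: the channel has one-sided interference and
`p(y₁ y₂ | x₁ x₂) = p(y₂ | x₂) p'(y₁ | x₁ y₂)` for some transition probabilities `p'`
(here `p(y₂ | x₂)` is the common value of `p(y₂ | x₁ x₂)` over all `x₁`). -/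
def WeakOneSided (W : DMIC X₁ X₂ Y₁ Y₂) : Prop :=
  W.OneSided ∧
    ∃ p' : X₁ → Y₂ → Y₁ → ℝ,
      (∀ x₁ y₂ y₁, 0 ≤ p' x₁ y₂ y₁) ∧
      (∀ x₁ y₂, ∑ y₁, p' x₁ y₂ y₁ = 1) ∧
      ∀ x₁ x₂ y₁ y₂, W.prob x₁ x₂ y₁ y₂ = W.marg₂ x₁ x₂ y₂ * p' x₁ y₂ y₁

/-- The memoryless extension `p(y₁ⁿ y₂ⁿ | x₁ⁿ x₂ⁿ) = ∏ᵢ p(y₁ᵢ y₂ᵢ | x₁ᵢ x₂ᵢ)`. -/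
def probN (W : DMIC X₁ X₂ Y₁ Y₂) {n : ℕ} (x₁ : Fin n → X₁) (x₂ : Fin n → X₂)
    (y₁ : Fin n → Y₁) (y₂ : Fin n → Y₂) : ℝ :=
  ∏ i, W.prob (x₁ i) (x₂ i) (y₁ i) (y₂ i)

/-- Average (over uniform independent messages) error probability of the first receiver. -/
def err₁ (W : DMIC X₁ X₂ Y₁ Y₂) {n M₁ M₂ : ℕ} (c : ICCode X₁ X₂ Y₁ Y₂ n M₁ M₂) : ℝ :=
  1 / ((M₁ : ℝ) * (M₂ : ℝ)) * ∑ w₁ : Fin M₁, ∑ w₂ : Fin M₂,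
    ∑ y₁ : Fin n → Y₁, ∑ y₂ : Fin n → Y₂,
      if c.dec₁ y₁ ≠ w₁ then W.probN (c.enc₁ w₁) (c.enc₂ w₂) y₁ y₂ else 0

/-- Average (over uniform independent messages) error probability of the second receiver. -/
def err₂ (W : DMIC X₁ X₂ Y₁ Y₂) {n M₁ M₂ : ℕ} (c : ICCode X₁ X₂ Y₁ Y₂ n M₁ M₂) : ℝ :=
  1 / ((M₁ : ℝ) * (M₂ : ℝ)) * ∑ w₁ : Fin M₁, ∑ w₂ : Fin M₂,
    ∑ y₁ : Fin n → Y₁, ∑ y₂ : Fin n → Y₂,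
      if c.dec₂ y₂ ≠ w₂ then W.probN (c.enc₁ w₁) (c.enc₂ w₂) y₁ y₂ else 0

/-- A pair of nonnegative rates (in bits per channel use) is achievable if there are codes with
`⌈2 ^ (n R₁)⌉` and `⌈2 ^ (n R₂)⌉` messages for which both average error probabilities tend to `0`. -/
def Achievable (W : DMIC X₁ X₂ Y₁ Y₂) (R₁ R₂ : ℝ) : Prop :=
  0 ≤ R₁ ∧ 0 ≤ R₂ ∧
    ∃ c : ∀ n : ℕ, ICCode X₁ X₂ Y₁ Y₂ n
        ⌈(2 : ℝ) ^ ((n : ℝ) * R₁)⌉₊ ⌈(2 : ℝ) ^ ((n : ℝ) * R₂)⌉₊,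
      Filter.Tendsto (fun n => W.err₁ (c n)) Filter.atTop (nhds 0) ∧
      Filter.Tendsto (fun n => W.err₂ (c n)) Filter.atTop (nhds 0)

/-- The capacity region: the closure of the set of achievable rate pairs. -/
def capacityRegion (W : DMIC X₁ X₂ Y₁ Y₂) : Set (ℝ × ℝ) :=
  closure {R | W.Achievable R.1 R.2}

/-- The sum rates `R₁ + R₂` of the rate pairs in the capacity region. -/
def sumRates (W : DMIC X₁ X₂ Y₁ Y₂) : Set ℝ :=
  (fun R : ℝ × ℝ => R.1 + R.2) '' W.capacityRegion

/-- The sum-rate capacity: the supremum of `R₁ + R₂` over the capacity region. -/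
def sumCapacity (W : DMIC X₁ X₂ Y₁ Y₂) : ℝ := sSup W.sumRates

variable [Fintype X₁] [Fintype X₂]

/-- `I(X₁; Y₁)` when the inputs are independent with laws `p₁` and `p₂`. -/
def info₁ (W : DMIC X₁ X₂ Y₁ Y₂) (p₁ : X₁ → ℝ) (p₂ : X₂ → ℝ) : ℝ :=
  mutualInfo fun x₁ y₁ => ∑ x₂, p₁ x₁ * p₂ x₂ * W.marg₁ x₁ x₂ y₁

/-- `I(X₂; Y₂)` when the inputs are independent with laws `p₁` and `p₂`. -/
def info₂ (W : DMIC X₁ X₂ Y₁ Y₂) (p₁ : X₁ → ℝ) (p₂ : X₂ → ℝ) : ℝ :=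
  mutualInfo fun x₂ y₂ => ∑ x₁, p₁ x₁ * p₂ x₂ * W.marg₂ x₁ x₂ y₂

end DMIC

end

/-! Converse. Weak interference makes the channel a cascade: X₂ produces Y₂ through a kernel `V`,
and (X₁, Y₂) produces Y₁ through a kernel `K`. For independent inputs Y₂ is independent of X₁, so
H(Y₂) − H(Y₁|X₁) = H(Y₂|X₁Y₁) − H(Y₁|X₁Y₂), and therefore I(X₁;Y₁) + I(X₂;Y₂) = H(Y₁) + H(Y₂|X₁Y₁) −
H(Y₁|X₁Y₂) − H(Y₂|X₂). This is `mutualInfo_add_mutualInfo_cascadeLaw`. It applies equally to the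
block channel from uniform messages to output sequences. There the two positive entropies are
subadditive over positions (`sum_mul_sum_log_cond_le`, which also weakens the conditioning from the
message and the whole sequence to the current letters), and the two negative ones split exactly
because the channel is memoryless. The letters at each position have independent inputs, so each
position contributes at most the single-letter maximum (`mutualInfo_add_mutualInfo_block_le`);
neither time sharing nor concavity is needed. Fano's inequality (`fano`) turns this into a bound on
rates.

Achievability holds for every interference channel. Each receiver treats the other user as noise:
averaged over the other user's random codebook, its channel is memoryless and point-to-point, and a
random code with a threshold decoder works below the mutual information (`exists_decoders`). One
pair of codebooks must serve both receivers, so it is chosen by averaging the sum of the two errors.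

The maximum over input laws is attained by compactness and continuity, and the upper bound on rates
passes to the closure. -/

noncomputable section

/-! ### Expectations under product weights -/

section FiniteSums

theorem sum_prod_apply {ι α : Type*} [Fintype ι] [DecidableEq ι] [Fintype α] (g : ι → α → ℝ) :
    ∑ y : ι → α, ∏ i, g i (y i) = ∏ i, ∑ a, g i a := by
  rw [Finset.prod_univ_sum, Fintype.piFinset_univ]

theorem sum_prod_mul_apply {ι α : Type*} [Fintype ι] [DecidableEq ι] [Fintype α] (g : ι → α → ℝ)
    (hg : ∀ i, ∑ a, g i a = 1) (i : ι) (F : α → ℝ) :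
    ∑ y : ι → α, (∏ j, g j (y j)) * F (y i) = ∑ a, g i a * F a := by
  -- The factor at coordinate `i` is spread over all coordinates, with value 1 off `i`, so that the
  -- sum of products factorises.
  have h : ∀ y : ι → α, (∏ j, g j (y j)) * F (y i)
      = ∏ j, (g j (y j) * if j = i then F (y j) else 1) := by
    intro y
    rw [Finset.prod_mul_distrib]
    simp
  simp_rw [h]
  rw [sum_prod_apply (fun j a => g j a * if j = i then F a else 1),
    Finset.prod_eq_single i]
  · simp
  · intro j _ hj
    simp [hj, hg]
  · simp

theorem sum_prod_mul_apply_mul_apply {ι α : Type*} [Fintype ι] [DecidableEq ι] [Fintype α] (g : ι → α → ℝ)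
    (hg : ∀ i, ∑ a, g i a = 1) {i k : ι} (hik : i ≠ k) (F G : α → ℝ) :
    ∑ y : ι → α, (∏ j, g j (y j)) * (F (y i) * G (y k))
      = (∑ a, g i a * F a) * ∑ a, g k a * G a := by
  have h : ∀ y : ι → α, (∏ j, g j (y j)) * (F (y i) * G (y k))
      = ∏ j, (g j (y j) * ((if j = i then F (y j) else 1) * if j = k then G (y j) else 1)) := by
    intro y
    rw [Finset.prod_mul_distrib, Finset.prod_mul_distrib]
    simp
  simp_rw [h]
  rw [sum_prod_apply (fun j a => g j a *
    ((if j = i then F a else 1) * if j = k then G a else 1)),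
    Finset.prod_eq_mul i k hik]
  · simp [hik, hik.symm]
  · intro j _ hj
    simp [hj.1, hj.2, hg]
  · simp
  · simp

end FiniteSums

/-! ### Laws of functions on a finite weighted space -/

section Pushforward

variable {Ω α β γ : Type*} [Fintype Ω]

open Classical in
/-- The mass that the weight `μ` gives to the fibre of `f` over `a`. -/
def pushforward (μ : Ω → ℝ) (f : Ω → α) (a : α) : ℝ := ∑ ω, if f ω = a then μ ω else 0

theorem sum_pushforward_mul [Fintype α] (μ : Ω → ℝ) (f : Ω → α) (F : α → ℝ) :
    ∑ a, pushforward μ f a * F a = ∑ ω, μ ω * F (f ω) := by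
  classical
  simp only [pushforward, Finset.sum_mul]
  rw [Finset.sum_comm]
  refine Finset.sum_congr rfl fun ω _ => ?_
  simp [ite_mul]

theorem sum_pushforward [Fintype α] (μ : Ω → ℝ) (f : Ω → α) :
    ∑ a, pushforward μ f a = ∑ ω, μ ω := by
  simpa using sum_pushforward_mul μ f fun _ => 1

theorem pushforward_eq_sum_mul [DecidableEq α] (μ : Ω → ℝ) (f : Ω → α) (a : α) :
    pushforward μ f a = ∑ ω, μ ω * if f ω = a then 1 else 0 := by
  unfold pushforward
  refine Finset.sum_congr rfl fun ω _ => ?_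
  by_cases h : f ω = a <;> simp [h]

theorem pushforward_pushforward [Fintype α] (μ : Ω → ℝ) (f : Ω → α) (h : α → β) (b : β) :
    pushforward (pushforward μ f) h b = pushforward μ (fun ω => h (f ω)) b := by
  classical
  rw [pushforward_eq_sum_mul, pushforward_eq_sum_mul,
    sum_pushforward_mul μ f (fun a => if h a = b then 1 else 0)]

theorem pushforward_nonneg {μ : Ω → ℝ} (hμ : ∀ ω, 0 ≤ μ ω) (f : Ω → α) (a : α) :
    0 ≤ pushforward μ f a :=
  Finset.sum_nonneg fun ω _ => by split_ifs <;> simp [hμ ω]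

theorem pushforward_pos {μ : Ω → ℝ} (hμ : ∀ ω, 0 ≤ μ ω) (f : Ω → α) {ω : Ω} (hω : 0 < μ ω) :
    0 < pushforward μ f (f ω) := by
  classical
  refine Finset.sum_pos' (fun ω _ => by split_ifs <;> simp [hμ ω]) ⟨ω, Finset.mem_univ _, ?_⟩
  simpa using hω

theorem sum_pushforward_pair_right [Fintype β] (μ : Ω → ℝ) (f : Ω → α) (g : Ω → β) (a : α) :
    ∑ b, pushforward μ (fun ω => (f ω, g ω)) (a, b) = pushforward μ f a := by
  classical
  simp only [pushforward, Prod.mk.injEq, ite_and]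
  rw [Finset.sum_comm]
  refine Finset.sum_congr rfl fun ω _ => ?_
  by_cases h : f ω = a <;> simp [h]

theorem sum_pushforward_pair_left [Fintype α] (μ : Ω → ℝ) (f : Ω → α) (g : Ω → β) (b : β) :
    ∑ a, pushforward μ (fun ω => (f ω, g ω)) (a, b) = pushforward μ g b := by
  classical
  simp only [pushforward, Prod.mk.injEq, ite_and]
  rw [Finset.sum_comm]
  refine Finset.sum_congr rfl fun ω _ => ?_
  by_cases h : g ω = b <;> simp [h]

theorem pushforward_prod_unit (μ : Ω → ℝ) (f : Ω → α) (a : α) :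
    pushforward μ (fun ω => (f ω, ())) (a, ()) = pushforward μ f a := by
  refine Finset.sum_congr rfl fun ω _ => ?_
  by_cases h : f ω = a <;> simp [h]

theorem pushforward_unit (μ : Ω → ℝ) : pushforward μ (fun _ => ()) () = ∑ ω, μ ω := by
  simp [pushforward]

end Pushforward

/-! ### Gibbs' inequality, subadditivity of conditional entropy, Fano -/

section Gibbs

variable {Ω α β γ : Type*} [Fintype Ω]

/-- Follows from log r ≤ r − 1. With r a ratio of a competing weight to the true one, this is
nonnegativity of relative entropy. -/
theorem sum_mul_log_nonpos {μ r : Ω → ℝ} (hμ : ∀ ω, 0 ≤ μ ω) (hr : ∀ ω, 0 < μ ω → 0 < r ω)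
    (h : ∑ ω, μ ω * r ω ≤ ∑ ω, μ ω) : ∑ ω, μ ω * Real.log (r ω) ≤ 0 := by
  have h1 : ∑ ω, μ ω * Real.log (r ω) ≤ ∑ ω, (μ ω * r ω - μ ω) := by
    refine Finset.sum_le_sum fun ω _ => ?_
    rcases (hμ ω).eq_or_lt with h0 | h0
    · simp [← h0]
    · have := mul_le_mul_of_nonneg_left (Real.log_le_sub_one_of_pos (hr ω h0)) h0.le
      linarith
  rw [Finset.sum_sub_distrib] at h1
  linarith

/-- Conditional entropy is subadditive, also when each summand conditions on less. -/
theorem sum_mul_sum_log_cond_le {ι : Type*} [Fintype ι] [Fintype α] [Fintype β] {μ : Ω → ℝ}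
    (hμ : ∀ ω, 0 ≤ μ ω) (f : Ω → ι → α) (g : Ω → β) (φ : ι → β → γ) :
    ∑ ω, μ ω * ∑ i, Real.log (pushforward μ (fun ω => (f ω i, φ i (g ω))) (f ω i, φ i (g ω)) /
        pushforward μ (fun ω => φ i (g ω)) (φ i (g ω)))
      ≤ ∑ ω, μ ω * Real.log (pushforward μ (fun ω => (f ω, g ω)) (f ω, g ω) /
        pushforward μ g (g ω)) := by
  classical
  set c : ι → α → β → ℝ := fun i a b =>
    pushforward μ (fun ω => (f ω i, φ i (g ω))) (a, φ i b) /
      pushforward μ (fun ω => φ i (g ω)) (φ i b) with hc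
  have hc0 : ∀ i a b, 0 ≤ c i a b := fun i a b =>
    div_nonneg (pushforward_nonneg hμ _ _) (pushforward_nonneg hμ _ _)
  have hcpos : ∀ ω, 0 < μ ω → ∀ i, 0 < c i (f ω i) (g ω) := fun ω hω i =>
    div_pos (pushforward_pos hμ (fun ω => (f ω i, φ i (g ω))) hω)
      (pushforward_pos hμ (fun ω => φ i (g ω)) hω)
  -- Only `≤ 1`: where the conditioning value has no mass, the quotient is 0 / 0 = 0.
  have hcsum : ∀ i b, ∑ a, c i a b ≤ 1 := by
    intro i b
    simp only [hc]
    rw [← Finset.sum_div, sum_pushforward_pair_left]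
    exact div_self_le_one _
  -- The competing law keeps the law of `g` and makes the coordinates of `f` conditionally
  -- independent given it, each with its own weaker conditioning.
  set R : (ι → α) × β → ℝ := fun x =>
    (∏ i, c i (x.1 i) x.2) * pushforward μ g x.2 / pushforward μ (fun ω => (f ω, g ω)) x with hR
  have key : ∑ ω, μ ω * Real.log (R (f ω, g ω)) ≤ 0 := by
    refine sum_mul_log_nonpos hμ (fun ω hω => ?_) ?_
    · exact div_pos (mul_pos (Finset.prod_pos fun i _ => hcpos ω hω i) (pushforward_pos hμ g hω))
        (pushforward_pos hμ (fun ω => (f ω, g ω)) hω)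
    · rw [← sum_pushforward_mul μ (fun ω => (f ω, g ω)) R]
      calc ∑ x, pushforward μ (fun ω => (f ω, g ω)) x * R x
          ≤ ∑ x : (ι → α) × β, (∏ i, c i (x.1 i) x.2) * pushforward μ g x.2 := by
            refine Finset.sum_le_sum fun x _ => ?_
            simp only [hR]
            rcases (pushforward_nonneg hμ (fun ω => (f ω, g ω)) x).eq_or_lt with h0 | h0
            · rw [← h0, zero_mul]
              exact mul_nonneg (Finset.prod_nonneg fun i _ => hc0 _ _ _)
                (pushforward_nonneg hμ _ _)
            · rw [mul_div_cancel₀ _ h0.ne']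
        _ = ∑ b, (∏ i, ∑ a, c i a b) * pushforward μ g b := by
            rw [Fintype.sum_prod_type_right]
            refine Finset.sum_congr rfl fun b _ => ?_
            dsimp only
            rw [← Finset.sum_mul, sum_prod_apply (fun i a => c i a b)]
        _ ≤ ∑ b, 1 * pushforward μ g b := by
            refine Finset.sum_le_sum fun b _ => ?_
            refine mul_le_mul_of_nonneg_right ?_ (pushforward_nonneg hμ _ _)
            exact Finset.prod_le_one (fun i _ => Finset.sum_nonneg fun a _ => hc0 _ _ _)
              (fun i _ => hcsum i b)
        _ = ∑ ω, μ ω := by simp [sum_pushforward]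
  rw [← sub_nonpos, ← Finset.sum_sub_distrib]
  refine le_trans (le_of_eq (Finset.sum_congr rfl fun ω _ => ?_)) key
  rcases (hμ ω).eq_or_lt with h0 | h0
  · simp [← h0]
  rw [← mul_sub]
  congr 1
  have h1 := pushforward_pos hμ (fun ω => (f ω, g ω)) h0
  have h2 := pushforward_pos hμ g h0
  have h3 : 0 < ∏ i, c i (f ω i) (g ω) := Finset.prod_pos fun i _ => hcpos ω h0 i
  simp only [hR]
  rw [Real.log_div (mul_pos h3 h2).ne' h1.ne', Real.log_mul h3.ne' h2.ne',
    Real.log_div h1.ne' h2.ne', Real.log_prod (fun i _ => (hcpos ω h0 i).ne')]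
  ring

theorem mutualInfo_pushforward [Fintype α] [Fintype β] (μ : Ω → ℝ) (f : Ω → α) (g : Ω → β) :
    mutualInfo (fun a b => pushforward μ (fun ω => (f ω, g ω)) (a, b)) =
      (∑ ω, μ ω * Real.log (pushforward μ (fun ω => (f ω, g ω)) (f ω, g ω) /
        (pushforward μ f (f ω) * pushforward μ g (g ω)))) / Real.log 2 := by
  unfold mutualInfo
  simp_rw [sum_pushforward_pair_right, sum_pushforward_pair_left]
  rw [← Fintype.sum_prod_type' (f := fun a b => pushforward μ (fun ω => (f ω, g ω)) (a, b) *
    Real.logb 2 (pushforward μ (fun ω => (f ω, g ω)) (a, b) /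
      (pushforward μ f a * pushforward μ g b)))]
  rw [sum_pushforward_mul μ (fun ω => (f ω, g ω)) (fun x => Real.logb 2
    (pushforward μ (fun ω => (f ω, g ω)) (x.1, x.2) /
      (pushforward μ f x.1 * pushforward μ g x.2))), Finset.sum_div]
  refine Finset.sum_congr rfl fun ω _ => ?_
  rw [Real.logb, mul_div_assoc]

/-- A Fano inequality for a uniformly distributed message. -/
theorem fano {M : ℕ} (hM : 0 < M) [Fintype α] {μ : Ω → ℝ}
    (hμ : ∀ ω, 0 ≤ μ ω) (hμ1 : ∑ ω, μ ω = 1) (w : Ω → Fin M) (y : Ω → α) (φ : α → Fin M)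
    (hw : ∀ m, pushforward μ w m = 1 / M) :
    (1 - ∑ ω, if φ (y ω) ≠ w ω then μ ω else 0) * Real.log M - Real.log 2 ≤
      ∑ ω, μ ω * Real.log (pushforward μ (fun ω => (w ω, y ω)) (w ω, y ω) /
        (pushforward μ w (w ω) * pushforward μ y (y ω))) := by
  have hM' : (0 : ℝ) < M := by exact_mod_cast hM
  -- Competing conditional law of the message: half the mass on the decoded message, half uniform.
  -- Then `M * t` is at least `M / 2` on correct decoding and exactly `1 / 2` on error, which costs
  -- a single `log 2` and avoids the binary entropy.
  set t : Fin M × α → ℝ := fun x => (if φ x.2 = x.1 then 1 / 2 else 0) + 1 / (2 * M) with ht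
  have htpos : ∀ x, 0 < t x := fun x => by simp only [ht]; split_ifs <;> positivity
  have htsum : ∀ a, ∑ m, t (m, a) = 1 := by
    intro a
    simp only [ht, Finset.sum_add_distrib]
    simp
    field_simp
    norm_num
  set R : Fin M × α → ℝ := fun x => t x * pushforward μ y x.2 /
    pushforward μ (fun ω => (w ω, y ω)) x with hR
  have key : ∑ ω, μ ω * Real.log (R (w ω, y ω)) ≤ 0 := by
    refine sum_mul_log_nonpos hμ (fun ω hω => ?_) ?_
    · exact div_pos (mul_pos (htpos _) (pushforward_pos hμ y hω))
        (pushforward_pos hμ (fun ω => (w ω, y ω)) hω)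
    · rw [← sum_pushforward_mul μ (fun ω => (w ω, y ω)) R]
      calc ∑ x, pushforward μ (fun ω => (w ω, y ω)) x * R x
          ≤ ∑ x, t x * pushforward μ y x.2 := by
            refine Finset.sum_le_sum fun x _ => ?_
            simp only [hR]
            rcases (pushforward_nonneg hμ (fun ω => (w ω, y ω)) x).eq_or_lt with h0 | h0
            · rw [← h0, zero_mul]
              exact mul_nonneg (htpos x).le (pushforward_nonneg hμ _ _)
            · rw [mul_div_cancel₀ _ h0.ne']
        _ = ∑ ω, μ ω := by
            rw [Fintype.sum_prod_type_right]
            simp only [← Finset.sum_mul, htsum, one_mul, sum_pushforward]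
  have hle : ∀ ω, μ ω * Real.log M - (if φ (y ω) ≠ w ω then μ ω else 0) * Real.log M
      - μ ω * Real.log 2 ≤ μ ω * Real.log (pushforward μ (fun ω => (w ω, y ω)) (w ω, y ω) /
        (pushforward μ w (w ω) * pushforward μ y (y ω))) + μ ω * Real.log (R (w ω, y ω)) := by
    intro ω
    rcases (hμ ω).eq_or_lt with h0 | h0
    · simp [← h0]
    have h1 := pushforward_pos hμ (fun ω => (w ω, y ω)) h0
    have h2 := pushforward_pos hμ y h0
    have h3 : Real.log (pushforward μ (fun ω => (w ω, y ω)) (w ω, y ω) /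
        (pushforward μ w (w ω) * pushforward μ y (y ω))) + Real.log (R (w ω, y ω))
        = Real.log (M * t (w ω, y ω)) := by
      rw [← Real.log_mul, hw]
      · congr 1
        simp only [hR]
        field_simp
      · rw [hw]; positivity
      · exact (div_pos (mul_pos (htpos _) h2) h1).ne'
    rw [← mul_add, h3]
    by_cases hφ : φ (y ω) = w ω
    · have h4 : Real.log (M / 2) ≤ Real.log (M * t (w ω, y ω)) := by
        refine Real.log_le_log (by positivity) ?_
        simp only [ht, hφ, if_true]
        have : (0 : ℝ) < 1 / (2 * M) := by positivity
        nlinarith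
      rw [Real.log_div hM'.ne' (by norm_num)] at h4
      have := mul_le_mul_of_nonneg_left h4 h0.le
      simp only [hφ, ne_eq, not_true_eq_false, if_false]
      linarith
    · have h4 : Real.log (M * t (w ω, y ω)) = - Real.log 2 := by
        rw [← Real.log_inv]
        congr 1
        simp only [ht, hφ, if_false]
        field_simp
        ring
      rw [h4]
      simp [hφ]
  have hsum := Finset.sum_le_sum fun ω (_ : ω ∈ Finset.univ) => hle ω
  simp only [Finset.sum_sub_distrib, Finset.sum_add_distrib, ← Finset.sum_mul, hμ1] at hsum
  linarith

end Gibbs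

/-! ### The cascade form of weak one-sided interference -/

section CascadeLaw

variable {A B C D : Type*}

/-- The joint law of independent inputs with laws `a` and `b`, of the output `d` of the second
input through `V`, and of the output of the first input and `d` through `K`. -/
def cascadeLaw (a : A → ℝ) (b : B → ℝ) (V : B → D → ℝ) (K : A → D → C → ℝ) (ω : A × B × D × C) :
    ℝ :=
  a ω.1 * (b ω.2.1 * (V ω.2.1 ω.2.2.1 * K ω.1 ω.2.2.1 ω.2.2.2))

theorem cascadeLaw_nonneg {a : A → ℝ} {b : B → ℝ} {V : B → D → ℝ} {K : A → D → C → ℝ}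
    (ha : ∀ x, 0 ≤ a x) (hb : ∀ z, 0 ≤ b z) (hV : ∀ z d, 0 ≤ V z d)
    (hK : ∀ x d c, 0 ≤ K x d c) (ω) : 0 ≤ cascadeLaw a b V K ω :=
  mul_nonneg (ha _) (mul_nonneg (hb _) (mul_nonneg (hV _ _) (hK _ _ _)))

variable [Fintype A] [Fintype B] [Fintype C] [Fintype D]

theorem sum_cascadeLaw_mul (a : A → ℝ) (b : B → ℝ) (V : B → D → ℝ) (K : A → D → C → ℝ)
    (F : A × B × D × C → ℝ) :
    ∑ ω, cascadeLaw a b V K ω * F ω =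
      ∑ x, a x * ∑ z, b z * ∑ d, V z d * ∑ c, K x d c * F (x, z, d, c) := by
  simp only [Fintype.sum_prod_type, cascadeLaw, Finset.mul_sum, mul_assoc]

variable {a : A → ℝ} {b : B → ℝ} {V : B → D → ℝ} {K : A → D → C → ℝ}

theorem sum_cascadeLaw (ha1 : ∑ x, a x = 1) (hb1 : ∑ z, b z = 1) (hV1 : ∀ z, ∑ d, V z d = 1)
    (hK1 : ∀ x d, ∑ c, K x d c = 1) : ∑ ω, cascadeLaw a b V K ω = 1 := by
  have := sum_cascadeLaw_mul a b V K fun _ => 1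
  simpa [ha1, hb1, hV1, hK1] using this

theorem pushforward_cascadeLaw_fst (hb1 : ∑ z, b z = 1) (hV1 : ∀ z, ∑ d, V z d = 1)
    (hK1 : ∀ x d, ∑ c, K x d c = 1) (x : A) :
    pushforward (cascadeLaw a b V K) (fun ω => ω.1) x = a x := by
  classical
  rw [pushforward_eq_sum_mul, sum_cascadeLaw_mul]
  simp [hK1, hV1, hb1]

theorem pushforward_cascadeLaw_snd (ha1 : ∑ x, a x = 1) (hV1 : ∀ z, ∑ d, V z d = 1)
    (hK1 : ∀ x d, ∑ c, K x d c = 1) (z : B) :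
    pushforward (cascadeLaw a b V K) (fun ω => ω.2.1) z = b z := by
  classical
  rw [pushforward_eq_sum_mul, sum_cascadeLaw_mul]
  simp [← Finset.sum_mul, hK1, hV1, ha1]

theorem pushforward_cascadeLaw_snd_mid (ha1 : ∑ x, a x = 1)
    (hK1 : ∀ x d, ∑ c, K x d c = 1) (z : B) (d : D) :
    pushforward (cascadeLaw a b V K) (fun ω => (ω.2.1, ω.2.2.1)) (z, d) = b z * V z d := by
  classical
  rw [pushforward_eq_sum_mul, sum_cascadeLaw_mul]
  simp [← Finset.sum_mul, hK1, ha1, ite_and]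

theorem pushforward_cascadeLaw_mid (ha1 : ∑ x, a x = 1)
    (hK1 : ∀ x d, ∑ c, K x d c = 1) (d : D) :
    pushforward (cascadeLaw a b V K) (fun ω => ω.2.2.1) d = ∑ z, b z * V z d := by
  classical
  rw [pushforward_eq_sum_mul, sum_cascadeLaw_mul]
  simp [← Finset.sum_mul, hK1, ha1]

theorem pushforward_cascadeLaw_fst_last (x : A) (c : C) :
    pushforward (cascadeLaw a b V K) (fun ω => (ω.1, ω.2.2.2)) (x, c) =
      a x * ∑ z, b z * ∑ d, V z d * K x d c := by
  classical
  rw [pushforward_eq_sum_mul, sum_cascadeLaw_mul]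
  simp [ite_and]

/-- The middle output depends only on the second input, so it is independent of the first; this is
where the cascade structure enters the converse. -/
theorem pushforward_cascadeLaw_mid_fst_last (ha1 : ∑ x, a x = 1)
    (hK1 : ∀ x d, ∑ c, K x d c = 1) (x : A) (d : D) (c : C) :
    pushforward (cascadeLaw a b V K) (fun ω => (ω.2.2.1, (ω.1, ω.2.2.2))) (d, (x, c)) =
      a x * (pushforward (cascadeLaw a b V K) (fun ω => ω.2.2.1) d * K x d c) := by
  classical
  rw [pushforward_cascadeLaw_mid ha1 hK1, pushforward_eq_sum_mul, sum_cascadeLaw_mul]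
  simp [ite_and, Finset.sum_mul, mul_assoc]

/-- In entropies the right side is H(C) + H(D|AC) − H(CD|AB). It holds pointwise on the support, by
writing the joint mass of (D, A, C) both as a(x) p(d) K and as p(x,c) p(d|x,c). The gain is that
every positive term is subadditive over blocks. -/
theorem mutualInfo_add_mutualInfo_cascadeLaw (ha : ∀ x, 0 ≤ a x) (hb : ∀ z, 0 ≤ b z)
    (hV : ∀ z d, 0 ≤ V z d) (hK : ∀ x d c, 0 ≤ K x d c)
    (ha1 : ∑ x, a x = 1) (hb1 : ∑ z, b z = 1) (hV1 : ∀ z, ∑ d, V z d = 1)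
    (hK1 : ∀ x d, ∑ c, K x d c = 1) {μ : A × B × D × C → ℝ} (hμ : μ = cascadeLaw a b V K) :
    mutualInfo (fun x c => pushforward μ (fun ω => (ω.1, ω.2.2.2)) (x, c)) +
      mutualInfo (fun z d => pushforward μ (fun ω => (ω.2.1, ω.2.2.1)) (z, d)) =
    (∑ ω, μ ω * (Real.log (V ω.2.1 ω.2.2.1 * K ω.1 ω.2.2.1 ω.2.2.2) -
        Real.log (pushforward μ (fun ω => ω.2.2.2) ω.2.2.2) -
        Real.log (pushforward μ (fun ω => (ω.2.2.1, (ω.1, ω.2.2.2))) (ω.2.2.1, (ω.1, ω.2.2.2)) /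
          pushforward μ (fun ω => (ω.1, ω.2.2.2)) (ω.1, ω.2.2.2)))) / Real.log 2 := by
  have hμ0 : ∀ ω, 0 ≤ μ ω := fun ω => hμ ▸ cascadeLaw_nonneg ha hb hV hK ω
  rw [mutualInfo_pushforward μ (fun ω => ω.1) (fun ω => ω.2.2.2),
    mutualInfo_pushforward μ (fun ω => ω.2.1) (fun ω => ω.2.2.1), ← add_div,
    ← Finset.sum_add_distrib]
  congr 1
  refine Finset.sum_congr rfl fun ω _ => ?_
  rcases (hμ0 ω).eq_or_lt with h0 | h0
  · simp [← h0]
  have p1 := pushforward_pos hμ0 (fun ω => (ω.1, ω.2.2.2)) h0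
  have p2 := pushforward_pos hμ0 (fun ω => ω.2.2.2) h0
  have p3 := pushforward_pos hμ0 (fun ω => ω.2.2.1) h0
  have p4 := pushforward_pos hμ0 (fun ω => (ω.2.1, ω.2.2.1)) h0
  have p5 := pushforward_pos hμ0 (fun ω => (ω.2.2.1, (ω.1, ω.2.2.2))) h0
  have p6 := pushforward_pos hμ0 (fun ω => ω.1) h0
  have p7 := pushforward_pos hμ0 (fun ω => ω.2.1) h0
  obtain ⟨x, z, d, c⟩ := ω
  have e6 : pushforward μ (fun ω => ω.1) x = a x := by
    rw [hμ, pushforward_cascadeLaw_fst hb1 hV1 hK1]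
  have e7 : pushforward μ (fun ω => ω.2.1) z = b z := by
    rw [hμ, pushforward_cascadeLaw_snd ha1 hV1 hK1]
  have e4 : pushforward μ (fun ω => (ω.2.1, ω.2.2.1)) (z, d) = b z * V z d := by
    rw [hμ, pushforward_cascadeLaw_snd_mid ha1 hK1]
  have e5 : pushforward μ (fun ω => (ω.2.2.1, (ω.1, ω.2.2.2))) (d, (x, c)) =
      a x * (pushforward μ (fun ω => ω.2.2.1) d * K x d c) := by
    rw [hμ, pushforward_cascadeLaw_mid_fst_last ha1 hK1]
  dsimp only at p1 p2 p3 p4 p5 p6 p7 ⊢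
  rw [e6] at p6
  rw [e7] at p7
  rw [e4] at p4
  rw [e5] at p5
  have hVp : 0 < V z d := pos_of_mul_pos_right p4 p7.le
  have hKp : 0 < K x d c := pos_of_mul_pos_right (pos_of_mul_pos_right p5 p6.le) p3.le
  rw [← mul_add]
  congr 1
  rw [e4, e5, e6, e7, Real.log_div p1.ne' (mul_pos p6 p2).ne', Real.log_mul p6.ne' p2.ne',
    Real.log_div p4.ne' (mul_pos p7 p3).ne', Real.log_mul p7.ne' hVp.ne',
    Real.log_mul p7.ne' p3.ne', Real.log_mul hVp.ne' hKp.ne',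
    Real.log_div p5.ne' p1.ne', Real.log_mul p6.ne' (mul_pos p3 hKp).ne',
    Real.log_mul p3.ne' hKp.ne']
  ring

end CascadeLaw

/-! ### Single-letterisation -/

section Block

variable {X₁ X₂ Y₁ Y₂ A B : Type*} [Fintype X₁] [Fintype X₂] [Fintype Y₁] [Fintype Y₂]
  [Fintype A] [Fintype B] {n : ℕ}

/-- All other positions integrate to 1, so the letters at position `i` again follow a cascade law,
with independent inputs because the messages are independent. -/
theorem sum_cascadeLaw_prod_mul {V : X₂ → Y₂ → ℝ} {K : X₁ → Y₂ → Y₁ → ℝ}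
    (hV1 : ∀ x, ∑ y, V x y = 1) (hK1 : ∀ x d, ∑ c, K x d c = 1) (a : A → ℝ) (b : B → ℝ)
    (f₁ : A → Fin n → X₁) (f₂ : B → Fin n → X₂) (i : Fin n) (F : X₁ × X₂ × Y₂ × Y₁ → ℝ) :
    ∑ ω, cascadeLaw a b (fun w (d : Fin n → Y₂) => ∏ j, V (f₂ w j) (d j))
        (fun w d (c : Fin n → Y₁) => ∏ j, K (f₁ w j) (d j) (c j)) ω *
          F (f₁ ω.1 i, f₂ ω.2.1 i, ω.2.2.1 i, ω.2.2.2 i) =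
      ∑ ω, cascadeLaw (pushforward a fun w => f₁ w i) (pushforward b fun w => f₂ w i) V K ω *
        F ω := by
  rw [sum_cascadeLaw_mul a b _ _ (fun ω : A × B × (Fin n → Y₂) × (Fin n → Y₁) => F (f₁ ω.1 i, f₂ ω.2.1 i, ω.2.2.1 i, ω.2.2.2 i)),
    sum_cascadeLaw_mul]
  rw [sum_pushforward_mul]
  refine Finset.sum_congr rfl fun w₁ _ => ?_
  rw [sum_pushforward_mul]
  congr 1
  refine Finset.sum_congr rfl fun w₂ _ => ?_
  congr 1
  dsimp only
  have h : ∀ d : Fin n → Y₂, ∑ c : Fin n → Y₁, (∏ j, K (f₁ w₁ j) (d j) (c j)) *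
      F (f₁ w₁ i, f₂ w₂ i, d i, c i) =
        ∑ c, K (f₁ w₁ i) (d i) c * F (f₁ w₁ i, f₂ w₂ i, d i, c) := fun d =>
    sum_prod_mul_apply (fun j c => K (f₁ w₁ j) (d j) c) (fun j => hK1 _ _) i
      (fun c => F (f₁ w₁ i, f₂ w₂ i, d i, c))
  simp_rw [h]
  exact sum_prod_mul_apply (fun j d => V (f₂ w₂ j) d) (fun j => hV1 _) i
    (fun d => ∑ c, K (f₁ w₁ i) d c * F (f₁ w₁ i, f₂ w₂ i, d, c))

/-- The single-letter bound: the information sum of a block code is at most the sum of the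
single-letter information sums, with independent inputs in each position. -/
theorem mutualInfo_add_mutualInfo_block_le {V : X₂ → Y₂ → ℝ} {K : X₁ → Y₂ → Y₁ → ℝ}
    (hV : ∀ x y, 0 ≤ V x y) (hK : ∀ x d c, 0 ≤ K x d c)
    (hV1 : ∀ x, ∑ y, V x y = 1) (hK1 : ∀ x d, ∑ c, K x d c = 1) {a : A → ℝ} {b : B → ℝ}
    (ha : a ∈ stdSimplex ℝ A) (hb : b ∈ stdSimplex ℝ B)
    (f₁ : A → Fin n → X₁) (f₂ : B → Fin n → X₂) {S : ℝ}
    (hS : ∀ p₁ ∈ stdSimplex ℝ X₁, ∀ p₂ ∈ stdSimplex ℝ X₂,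
      mutualInfo (fun x c =>
          pushforward (cascadeLaw p₁ p₂ V K) (fun ω => (ω.1, ω.2.2.2)) (x, c)) +
        mutualInfo (fun z d =>
          pushforward (cascadeLaw p₁ p₂ V K) (fun ω => (ω.2.1, ω.2.2.1)) (z, d)) ≤ S)
    {μ : A × B × (Fin n → Y₂) × (Fin n → Y₁) → ℝ}
    (hμ : μ = cascadeLaw a b (fun w (d : Fin n → Y₂) => ∏ j, V (f₂ w j) (d j))
        (fun w d (c : Fin n → Y₁) => ∏ j, K (f₁ w j) (d j) (c j))) :
    mutualInfo (fun x c => pushforward μ (fun ω => (ω.1, ω.2.2.2)) (x, c)) +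
      mutualInfo (fun z d => pushforward μ (fun ω => (ω.2.1, ω.2.2.1)) (z, d)) ≤ n * S := by
  classical
  have hl2 : 0 < Real.log 2 := Real.log_pos one_lt_two
  have hμ0 : ∀ ω, 0 ≤ μ ω := fun ω => hμ ▸ cascadeLaw_nonneg ha.1 hb.1
    (fun _ _ => Finset.prod_nonneg fun _ _ => hV _ _)
    (fun _ _ _ => Finset.prod_nonneg fun _ _ => hK _ _ _) ω
  set ν : Fin n → X₁ × X₂ × Y₂ × Y₁ → ℝ := fun i =>
    cascadeLaw (pushforward a fun w => f₁ w i) (pushforward b fun w => f₂ w i) V K with hν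
  set T : Fin n → A × B × (Fin n → Y₂) × (Fin n → Y₁) → X₁ × X₂ × Y₂ × Y₁ := fun i ω =>
    (f₁ ω.1 i, f₂ ω.2.1 i, ω.2.2.1 i, ω.2.2.2 i) with hT
  have hsum : ∀ i (F : X₁ × X₂ × Y₂ × Y₁ → ℝ), ∑ ω, μ ω * F (T i ω) = ∑ ω, ν i ω * F ω := fun i F => by
    rw [hμ]; exact sum_cascadeLaw_prod_mul hV1 hK1 a b f₁ f₂ i F
  have hpush : ∀ i, pushforward μ (T i) = ν i := fun i => by
    funext x
    rw [pushforward_eq_sum_mul, hsum i (fun ω => if ω = x then 1 else 0)]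
    simp
  have hpa : ∀ i, (pushforward a fun w => f₁ w i) ∈ stdSimplex ℝ X₁ := fun i =>
    ⟨fun x => pushforward_nonneg ha.1 _ _, (sum_pushforward _ _).trans ha.2⟩
  have hpb : ∀ i, (pushforward b fun w => f₂ w i) ∈ stdSimplex ℝ X₂ := fun i =>
    ⟨fun x => pushforward_nonneg hb.1 _ _, (sum_pushforward _ _).trans hb.2⟩
  have hsingle : ∀ i, ∑ ω, ν i ω * (Real.log (V ω.2.1 ω.2.2.1 * K ω.1 ω.2.2.1 ω.2.2.2) -
        Real.log (pushforward (ν i) (fun ω => ω.2.2.2) ω.2.2.2) -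
        Real.log (pushforward (ν i) (fun ω => (ω.2.2.1, (ω.1, ω.2.2.2)))
            (ω.2.2.1, (ω.1, ω.2.2.2)) /
          pushforward (ν i) (fun ω => (ω.1, ω.2.2.2)) (ω.1, ω.2.2.2))) ≤ S * Real.log 2 := by
    intro i
    have := hS _ (hpa i) _ (hpb i)
    rw [mutualInfo_add_mutualInfo_cascadeLaw (hpa i).1 (hpb i).1 hV hK (hpa i).2 (hpb i).2 hV1 hK1
      rfl, div_le_iff₀ hl2] at this
    exact this
  rw [mutualInfo_add_mutualInfo_cascadeLaw ha.1 hb.1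
    (fun _ _ => Finset.prod_nonneg fun _ _ => hV _ _)
    (fun _ _ _ => Finset.prod_nonneg fun _ _ => hK _ _ _) ha.2 hb.2
    (fun w => by rw [sum_prod_apply (fun j y => V (f₂ w j) y)]; simp [hV1])
    (fun w d => by rw [sum_prod_apply (fun j y => K (f₁ w j) (d j) y)]; simp [hK1]) hμ,
    div_le_iff₀ hl2]
  have hμ1 : ∑ ω, μ ω = 1 := by
    rw [hμ]
    exact sum_cascadeLaw ha.2 hb.2
      (fun w => by rw [sum_prod_apply (fun j y => V (f₂ w j) y)]; simp [hV1])
      (fun w d => by rw [sum_prod_apply (fun j y => K (f₁ w j) (d j) y)]; simp [hK1])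
  -- Trivial conditioning: H(Y₁ⁿ) ≤ ∑ H(Y₁ᵢ).
  have hcond1 := sum_mul_sum_log_cond_le hμ0 (fun ω => ω.2.2.2) (fun _ => ())
    (fun _ _ => ())
  -- H(Y₂ⁿ | W₁ Y₁ⁿ) ≤ ∑ H(Y₂ᵢ | X₁ᵢ Y₁ᵢ), since X₁ᵢ is a function of the message W₁.
  have hcond2 := sum_mul_sum_log_cond_le hμ0 (fun ω => ω.2.2.1)
    (fun ω => (ω.1, ω.2.2.2)) (fun i x => (f₁ x.1 i, x.2 i))
  simp only [pushforward_prod_unit, pushforward_unit, hμ1, div_one] at hcond1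
  dsimp only at hcond2
  set G : Fin n → X₁ × X₂ × Y₂ × Y₁ → ℝ := fun i ω =>
    Real.log (V ω.2.1 ω.2.2.1 * K ω.1 ω.2.2.1 ω.2.2.2) -
        Real.log (pushforward (ν i) (fun ω => ω.2.2.2) ω.2.2.2) -
        Real.log (pushforward (ν i) (fun ω => (ω.2.2.1, (ω.1, ω.2.2.2)))
            (ω.2.2.1, (ω.1, ω.2.2.2)) /
          pushforward (ν i) (fun ω => (ω.1, ω.2.2.2)) (ω.1, ω.2.2.2)) with hG
  have hGT : ∀ i ω, G i (T i ω) =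
      Real.log (V (f₂ ω.2.1 i) (ω.2.2.1 i) * K (f₁ ω.1 i) (ω.2.2.1 i) (ω.2.2.2 i)) -
      Real.log (pushforward μ (fun ω => ω.2.2.2 i) (ω.2.2.2 i)) -
      Real.log (pushforward μ (fun ω => (ω.2.2.1 i, (f₁ ω.1 i, ω.2.2.2 i)))
            (ω.2.2.1 i, (f₁ ω.1 i, ω.2.2.2 i)) /
          pushforward μ (fun ω => (f₁ ω.1 i, ω.2.2.2 i)) (f₁ ω.1 i, ω.2.2.2 i)) := by
    intro i ω
    simp only [hG, ← hpush, pushforward_pushforward]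
    rfl
  -- The channel term is exactly additive; a vanishing factor, which would break the logarithm of
  -- the product, forces `μ ω = 0`.
  have hlog : ∀ ω, μ ω * Real.log ((∏ j, V (f₂ ω.2.1 j) (ω.2.2.1 j)) *
      ∏ j, K (f₁ ω.1 j) (ω.2.2.1 j) (ω.2.2.2 j)) =
        μ ω * ∑ j, Real.log (V (f₂ ω.2.1 j) (ω.2.2.1 j) *
          K (f₁ ω.1 j) (ω.2.2.1 j) (ω.2.2.2 j)) := by
    intro ω
    rcases eq_or_ne (μ ω) 0 with h0 | h0
    · simp [h0]
    rw [← Finset.prod_mul_distrib, Real.log_prod]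
    intro j _ hj
    refine h0 ?_
    have : (∏ j, V (f₂ ω.2.1 j) (ω.2.2.1 j)) *
      ∏ j, K (f₁ ω.1 j) (ω.2.2.1 j) (ω.2.2.2 j) = 0 := by
      rw [← Finset.prod_mul_distrib]
      exact Finset.prod_eq_zero (Finset.mem_univ j) hj
    rw [hμ, cascadeLaw, this]
    ring
  have hfin : ∑ i, ∑ ω, μ ω * G i (T i ω) ≤ n * S * Real.log 2 := by
    calc ∑ i, ∑ ω, μ ω * G i (T i ω) ≤ ∑ _i : Fin n, S * Real.log 2 :=
          Finset.sum_le_sum fun i _ => (hsum i (G i)).trans_le (hsingle i)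
      _ = n * S * Real.log 2 := by simp [mul_assoc]
  rw [Finset.sum_comm] at hfin
  simp only [← Finset.mul_sum, hGT, Finset.sum_sub_distrib, mul_sub] at hfin
  simp only [mul_sub, Finset.sum_sub_distrib, hlog]
  linarith

end Block

/-! ### The converse -/

namespace DMIC

variable {X₁ X₂ Y₁ Y₂ : Type*} [Fintype Y₁] [Fintype Y₂]

theorem marg₁_nonneg (W : DMIC X₁ X₂ Y₁ Y₂) (x₁ : X₁) (x₂ : X₂) (y₁ : Y₁) :
    0 ≤ W.marg₁ x₁ x₂ y₁ :=
  Finset.sum_nonneg fun _ _ => W.prob_nonneg _ _ _ _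

theorem marg₂_nonneg (W : DMIC X₁ X₂ Y₁ Y₂) (x₁ : X₁) (x₂ : X₂) (y₂ : Y₂) :
    0 ≤ W.marg₂ x₁ x₂ y₂ :=
  Finset.sum_nonneg fun _ _ => W.prob_nonneg _ _ _ _

theorem sum_marg₁ (W : DMIC X₁ X₂ Y₁ Y₂) (x₁ : X₁) (x₂ : X₂) : ∑ y₁, W.marg₁ x₁ x₂ y₁ = 1 :=
  W.prob_sum x₁ x₂

theorem sum_marg₂ (W : DMIC X₁ X₂ Y₁ Y₂) (x₁ : X₁) (x₂ : X₂) : ∑ y₂, W.marg₂ x₁ x₂ y₂ = 1 := by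
  rw [← W.prob_sum x₁ x₂, Finset.sum_comm]
  rfl

theorem WeakOneSided.exists_cascade [Nonempty X₁] {W : DMIC X₁ X₂ Y₁ Y₂} (hW : W.WeakOneSided) :
    ∃ (V : X₂ → Y₂ → ℝ) (K : X₁ → Y₂ → Y₁ → ℝ), (∀ x y, 0 ≤ V x y) ∧ (∀ x d c, 0 ≤ K x d c) ∧
      (∀ x, ∑ y, V x y = 1) ∧ (∀ x d, ∑ c, K x d c = 1) ∧
      (∀ x₁ x₂ y₁ y₂, W.prob x₁ x₂ y₁ y₂ = V x₂ y₂ * K x₁ y₂ y₁) ∧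
      ∀ x₁ x₂ y₂, W.marg₂ x₁ x₂ y₂ = V x₂ y₂ := by
  obtain ⟨h1, K, hK, hK1, h⟩ := hW
  refine ⟨W.marg₂ (Classical.arbitrary X₁), K, W.marg₂_nonneg _, hK, W.sum_marg₂ _, hK1,
    fun x₁ x₂ y₁ y₂ => ?_, fun x₁ x₂ y₂ => h1 _ _ _ _⟩
  rw [h, h1 x₁ (Classical.arbitrary X₁)]

theorem err₁_nonneg (W : DMIC X₁ X₂ Y₁ Y₂) {n M₁ M₂ : ℕ} (c : ICCode X₁ X₂ Y₁ Y₂ n M₁ M₂) :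
    0 ≤ W.err₁ c := by
  refine mul_nonneg (by positivity) (Finset.sum_nonneg fun _ _ => Finset.sum_nonneg fun _ _ =>
    Finset.sum_nonneg fun _ _ => Finset.sum_nonneg fun _ _ => ?_)
  split_ifs
  exacts [Finset.prod_nonneg fun _ _ => W.prob_nonneg _ _ _ _, le_rfl]

theorem err₂_nonneg (W : DMIC X₁ X₂ Y₁ Y₂) {n M₁ M₂ : ℕ} (c : ICCode X₁ X₂ Y₁ Y₂ n M₁ M₂) :
    0 ≤ W.err₂ c := by
  refine mul_nonneg (by positivity) (Finset.sum_nonneg fun _ _ => Finset.sum_nonneg fun _ _ =>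
    Finset.sum_nonneg fun _ _ => Finset.sum_nonneg fun _ _ => ?_)
  split_ifs
  exacts [Finset.prod_nonneg fun _ _ => W.prob_nonneg _ _ _ _, le_rfl]

variable [Fintype X₁] [Fintype X₂]

theorem info₁_eq_mutualInfo_cascadeLaw {W : DMIC X₁ X₂ Y₁ Y₂} {V : X₂ → Y₂ → ℝ}
    {K : X₁ → Y₂ → Y₁ → ℝ}
    (h : ∀ x₁ x₂ y₁ y₂, W.prob x₁ x₂ y₁ y₂ = V x₂ y₂ * K x₁ y₂ y₁)
    (p₁ : X₁ → ℝ) (p₂ : X₂ → ℝ) :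
    W.info₁ p₁ p₂ = mutualInfo (fun x c =>
      pushforward (cascadeLaw p₁ p₂ V K) (fun ω => (ω.1, ω.2.2.2)) (x, c)) := by
  unfold info₁
  congr 1
  funext x c
  rw [pushforward_cascadeLaw_fst_last, Finset.mul_sum]
  simp only [marg₁, h, mul_assoc]

theorem info₂_eq_mutualInfo_cascadeLaw {W : DMIC X₁ X₂ Y₁ Y₂} {V : X₂ → Y₂ → ℝ}
    {K : X₁ → Y₂ → Y₁ → ℝ} (hK1 : ∀ x d, ∑ c, K x d c = 1)
    (h : ∀ x₁ x₂ y₂, W.marg₂ x₁ x₂ y₂ = V x₂ y₂)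
    {p₁ : X₁ → ℝ} (hp₁ : p₁ ∈ stdSimplex ℝ X₁) (p₂ : X₂ → ℝ) :
    W.info₂ p₁ p₂ = mutualInfo (fun z d =>
      pushforward (cascadeLaw p₁ p₂ V K) (fun ω => (ω.2.1, ω.2.2.1)) (z, d)) := by
  unfold info₂
  congr 1
  funext z d
  rw [pushforward_cascadeLaw_snd_mid hp₁.2 hK1]
  simp only [h, mul_assoc, ← Finset.sum_mul, hp₁.2, one_mul]

theorem uniform_mem_stdSimplex {M : ℕ} (hM : 0 < M) :
    (fun _ : Fin M => 1 / (M : ℝ)) ∈ stdSimplex ℝ (Fin M) := by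
  refine ⟨fun _ => by positivity, ?_⟩
  simp
  field_simp

/-- Fano for each receiver combined with the single-letter bound for uniform messages; the 2
collects the two `log 2` losses and disappears after division by `n`. -/
theorem WeakOneSided.block_converse [Nonempty X₁] {W : DMIC X₁ X₂ Y₁ Y₂}
    (hW : W.WeakOneSided) {S : ℝ}
    (hS : ∀ p₁ ∈ stdSimplex ℝ X₁, ∀ p₂ ∈ stdSimplex ℝ X₂, W.info₁ p₁ p₂ + W.info₂ p₁ p₂ ≤ S)
    {n M₁ M₂ : ℕ} (hM₁ : 0 < M₁) (hM₂ : 0 < M₂) (c : ICCode X₁ X₂ Y₁ Y₂ n M₁ M₂) :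
    (1 - W.err₁ c) * Real.log M₁ + (1 - W.err₂ c) * Real.log M₂ ≤
      (n * S + 2) * Real.log 2 := by
  obtain ⟨V, K, hV, hK, hV1, hK1, hVK, hmarg⟩ := hW.exists_cascade
  have ha := uniform_mem_stdSimplex hM₁
  have hb := uniform_mem_stdSimplex hM₂
  have hVn : ∀ w, ∑ d : Fin n → Y₂, ∏ j, V (c.enc₂ w j) (d j) = 1 := fun w => by
    rw [sum_prod_apply (fun j y => V (c.enc₂ w j) y)]; simp [hV1]
  have hKn : ∀ w (d : Fin n → Y₂),
      ∑ e : Fin n → Y₁, ∏ j, K (c.enc₁ w j) (d j) (e j) = 1 := fun w d => by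
    rw [sum_prod_apply (fun j y => K (c.enc₁ w j) (d j) y)]; simp [hK1]
  obtain ⟨μ, hμ⟩ : ∃ μ, μ = cascadeLaw (fun _ : Fin M₁ => 1 / (M₁ : ℝ))
    (fun _ : Fin M₂ => 1 / (M₂ : ℝ)) (fun w (d : Fin n → Y₂) => ∏ j, V (c.enc₂ w j) (d j))
    (fun w d (e : Fin n → Y₁) => ∏ j, K (c.enc₁ w j) (d j) (e j)) := ⟨_, rfl⟩
  have hμ0 : ∀ ω, 0 ≤ μ ω := fun ω => hμ ▸ cascadeLaw_nonneg ha.1 hb.1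
    (fun _ _ => Finset.prod_nonneg fun _ _ => hV _ _)
    (fun _ _ _ => Finset.prod_nonneg fun _ _ => hK _ _ _) ω
  have hμ1 : ∑ ω, μ ω = 1 := hμ ▸ sum_cascadeLaw ha.2 hb.2 hVn hKn
  have hμapp : ∀ w₁ w₂ y₂ y₁, μ (w₁, w₂, y₂, y₁) =
      1 / ((M₁ : ℝ) * M₂) * W.probN (c.enc₁ w₁) (c.enc₂ w₂) y₁ y₂ := by
    intro w₁ w₂ y₂ y₁
    simp only [hμ, cascadeLaw, probN, hVK, Finset.prod_mul_distrib]
    field_simp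
  have hblock := mutualInfo_add_mutualInfo_block_le hV hK hV1 hK1 ha hb c.enc₁ c.enc₂
    (S := S) (fun p₁ hp₁ p₂ hp₂ => by
      rw [← info₁_eq_mutualInfo_cascadeLaw hVK, ← info₂_eq_mutualInfo_cascadeLaw hK1 hmarg hp₁]
      exact hS p₁ hp₁ p₂ hp₂) hμ
  rw [mutualInfo_pushforward μ (fun ω => ω.1) (fun ω => ω.2.2.2),
    mutualInfo_pushforward μ (fun ω => ω.2.1) (fun ω => ω.2.2.1), ← add_div,
    div_le_iff₀ (Real.log_pos one_lt_two)] at hblock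
  have hf1 := fano hM₁ hμ0 hμ1 (fun ω => ω.1) (fun ω => ω.2.2.2) c.dec₁ (fun m => by
    rw [hμ, pushforward_cascadeLaw_fst hb.2 hVn hKn])
  have hf2 := fano hM₂ hμ0 hμ1 (fun ω => ω.2.1) (fun ω => ω.2.2.1) c.dec₂ (fun m => by
    rw [hμ, pushforward_cascadeLaw_snd ha.2 hVn hKn])
  have he1 : (∑ ω, if c.dec₁ ω.2.2.2 ≠ ω.1 then μ ω else 0) = W.err₁ c := by
    simp only [err₁, Fintype.sum_prod_type, hμapp, Finset.mul_sum, mul_ite, mul_zero]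
    refine Finset.sum_congr rfl fun w₁ _ => Finset.sum_congr rfl fun w₂ _ => Finset.sum_comm
  have he2 : (∑ ω, if c.dec₂ ω.2.2.1 ≠ ω.2.1 then μ ω else 0) = W.err₂ c := by
    simp only [err₂, Fintype.sum_prod_type, hμapp, Finset.mul_sum, mul_ite, mul_zero]
    refine Finset.sum_congr rfl fun w₁ _ => Finset.sum_congr rfl fun w₂ _ => Finset.sum_comm
  rw [he1] at hf1
  rw [he2] at hf2
  linarith

theorem mul_log_two_le_log_ceil (n : ℕ) (R : ℝ) :
    n * R * Real.log 2 ≤ Real.log ⌈(2 : ℝ) ^ ((n : ℝ) * R)⌉₊ := by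
  rw [← Real.log_rpow two_pos]
  exact Real.log_le_log (Real.rpow_pos_of_pos two_pos _) (Nat.le_ceil _)

theorem WeakOneSided.add_le_of_achievable [Nonempty X₁] {W : DMIC X₁ X₂ Y₁ Y₂}
    (hW : W.WeakOneSided) {S : ℝ}
    (hS : ∀ p₁ ∈ stdSimplex ℝ X₁, ∀ p₂ ∈ stdSimplex ℝ X₂, W.info₁ p₁ p₂ + W.info₂ p₁ p₂ ≤ S)
    {R₁ R₂ : ℝ} (hR : W.Achievable R₁ R₂) : R₁ + R₂ ≤ S := by
  obtain ⟨hR₁, hR₂, c, h₁, h₂⟩ := hR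
  have hl2 : 0 < Real.log 2 := Real.log_pos one_lt_two
  have hlhs : Filter.Tendsto (fun n => (1 - W.err₁ (c n)) * R₁ + (1 - W.err₂ (c n)) * R₂)
      Filter.atTop (nhds (R₁ + R₂)) := by
    have := ((h₁.const_sub 1).mul_const R₁).add ((h₂.const_sub 1).mul_const R₂)
    simpa using this
  have hrhs : Filter.Tendsto (fun n : ℕ => S + 2 / (n : ℝ)) Filter.atTop (nhds S) := by
    simpa using (tendsto_const_div_atTop_nhds_zero_nat (2 : ℝ)).const_add S
  refine le_of_tendsto_of_tendsto hlhs hrhs ?_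
  -- Errors below 1 make the factors `1 - err` nonnegative, so `log M` may be replaced by its lower
  -- bound `n R log 2`.
  filter_upwards [h₁.eventually_lt_const one_pos, h₂.eventually_lt_const one_pos,
    Filter.eventually_gt_atTop 0] with n hn₁ hn₂ hn
  have hpos : ∀ R : ℝ, 0 < ⌈(2 : ℝ) ^ ((n : ℝ) * R)⌉₊ := fun R =>
    Nat.ceil_pos.2 (Real.rpow_pos_of_pos two_pos _)
  have hb := hW.block_converse hS (hpos R₁) (hpos R₂) (c n)
  have h1 := mul_le_mul_of_nonneg_left (mul_log_two_le_log_ceil n R₁) (sub_nonneg.2 hn₁.le)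
  have h2 := mul_le_mul_of_nonneg_left (mul_log_two_le_log_ceil n R₂) (sub_nonneg.2 hn₂.le)
  have hn' : (0 : ℝ) < n := by exact_mod_cast hn
  have h3 : (n * ((1 - W.err₁ (c n)) * R₁ + (1 - W.err₂ (c n)) * R₂)) * Real.log 2 ≤
      (n * S + 2) * Real.log 2 := by linarith
  have h4 := le_of_mul_le_mul_right h3 hl2
  have h5 : (n : ℝ) * (S + 2 / n) = n * S + 2 := by field_simp
  rw [← h5] at h4
  exact le_of_mul_le_mul_left h4 hn'

end DMIC

/-! ### Random coding for a point-to-point channel -/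

section PointToPoint

variable {X Y : Type*} [Fintype X]

/-- The output law of a channel `q` with input law `p`. -/
def outputLaw (p : X → ℝ) (q : X → Y → ℝ) (y : Y) : ℝ := ∑ x, p x * q x y

/-- The exponential of the information density of input and output letters. -/
def densityRatio (p : X → ℝ) (q : X → Y → ℝ) (x : X) (y : Y) : ℝ := q x y / outputLaw p q y

/-- Decode to the only message whose codeword has information density with the output above the
threshold, if there is exactly one. -/
def thresholdDecoder {n M : ℕ} (hM : 0 < M) (p : X → ℝ) (q : X → Y → ℝ) (θ : ℝ)
    (e : Fin M → Fin n → X) (y : Fin n → Y) : Fin M := by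
  classical
  exact if h : ∃! w, θ < ∏ i, densityRatio p q (e w i) (y i) then h.choose else ⟨0, hM⟩

theorem thresholdDecoder_eq {n M : ℕ} (hM : 0 < M) (p : X → ℝ) (q : X → Y → ℝ) {θ : ℝ}
    {e : Fin M → Fin n → X} {y : Fin n → Y} {w : Fin M}
    (hw : θ < ∏ i, densityRatio p q (e w i) (y i))
    (hne : ∀ w', w' ≠ w → ∏ i, densityRatio p q (e w' i) (y i) ≤ θ) :
    thresholdDecoder hM p q θ e y = w := by
  have h : ∃! w, θ < ∏ i, densityRatio p q (e w i) (y i) :=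
    ⟨w, hw, fun w' hw' => by_contra fun hn => (hne w' hn).not_gt hw'⟩
  rw [thresholdDecoder, dif_pos h]
  exact h.unique h.choose_spec.1 hw

/-- Union bound: an error requires the true codeword to fall below the threshold or a wrong one to
exceed it. -/
theorem ite_thresholdDecoder_le {n M : ℕ} (hM : 0 < M) (p : X → ℝ) (q : X → Y → ℝ) (θ : ℝ)
    (e : Fin M → Fin n → X) (y : Fin n → Y) (w : Fin M) {a : ℝ} (ha : 0 ≤ a) :
    (if thresholdDecoder hM p q θ e y ≠ w then a else 0) ≤
      a * (if ∏ i, densityRatio p q (e w i) (y i) ≤ θ then 1 else 0) +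
        ∑ w' ∈ Finset.univ.erase w,
          a * (if θ < ∏ i, densityRatio p q (e w' i) (y i) then 1 else 0) := by
  have hterm : ∀ w', 0 ≤ a * (if θ < ∏ i, densityRatio p q (e w' i) (y i) then (1 : ℝ) else 0) :=
    fun w' => by split_ifs <;> simp [ha]
  have hsum := Finset.sum_nonneg fun w' (_ : w' ∈ Finset.univ.erase w) => hterm w'
  by_cases hw : ∏ i, densityRatio p q (e w i) (y i) ≤ θ
  · rw [if_pos hw]
    split_ifs <;> linarith
  by_cases hne : ∀ w', w' ≠ w → ∏ i, densityRatio p q (e w' i) (y i) ≤ θ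
  · rw [thresholdDecoder_eq hM p q (not_le.1 hw) hne]
    simpa [hw] using hsum
  · push Not at hne
    obtain ⟨w', hw', hlt⟩ := hne
    have h1 := Finset.single_le_sum (fun w' _ => hterm w')
      (Finset.mem_erase.2 ⟨hw', Finset.mem_univ w'⟩)
    rw [if_pos hlt, mul_one] at h1
    rw [if_neg hw]
    split_ifs <;> linarith

variable {p : X → ℝ} {q : X → Y → ℝ}

theorem outputLaw_nonneg (hp : p ∈ stdSimplex ℝ X) (hq : ∀ x y, 0 ≤ q x y) (y : Y) :
    0 ≤ outputLaw p q y :=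
  Finset.sum_nonneg fun x _ => mul_nonneg (hp.1 x) (hq x y)

theorem densityRatio_nonneg (hp : p ∈ stdSimplex ℝ X) (hq : ∀ x y, 0 ≤ q x y) (x : X) (y : Y) :
    0 ≤ densityRatio p q x y :=
  div_nonneg (hq x y) (outputLaw_nonneg hp hq y)

theorem densityRatio_pos (hp : p ∈ stdSimplex ℝ X) (hq : ∀ x y, 0 ≤ q x y) {x : X} {y : Y}
    (h : 0 < p x * q x y) : 0 < densityRatio p q x y := by
  have h1 : 0 < outputLaw p q y :=
    Finset.sum_pos' (fun x _ => mul_nonneg (hp.1 x) (hq x y)) ⟨x, Finset.mem_univ x, h⟩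
  exact div_pos (pos_of_mul_pos_right h (hp.1 x)) h1

/-- Strict when the output law vanishes at `y` but `q x y` does not, which can occur at inputs of
mass 0; the ratio is then 0 by convention. -/
theorem outputLaw_mul_densityRatio_le (hq : ∀ x y, 0 ≤ q x y) (x : X) (y : Y) :
    outputLaw p q y * densityRatio p q x y ≤ q x y := by
  rcases eq_or_ne (outputLaw p q y) 0 with h | h
  · simp [h, hq x y]
  · exact (mul_div_cancel₀ _ h).le

variable [Fintype Y]

theorem mutualInfo_eq_sum_densityRatio (hq1 : ∀ x, ∑ y, q x y = 1) :
    mutualInfo (fun x y => p x * q x y) =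
      (∑ x, ∑ y, p x * q x y * Real.log (densityRatio p q x y)) / Real.log 2 := by
  unfold mutualInfo
  rw [Finset.sum_div]
  refine Finset.sum_congr rfl fun x _ => ?_
  rw [Finset.sum_div]
  refine Finset.sum_congr rfl fun y _ => ?_
  dsimp only
  rw [← Finset.mul_sum, hq1, mul_one, Real.logb]
  rcases eq_or_ne (p x) 0 with h | h
  · simp [h]
  · rw [mul_div_mul_left _ _ h]
    exact (mul_div_assoc _ _ _).symm

/-- As a function of `s` the moment equals 1 at 0 and has derivative γ − J < 0 there, J being the
mean information density; hence it drops below 1 for some small `s > 0`. -/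
theorem exists_exp_moment_lt_one (hp : p ∈ stdSimplex ℝ X)
    (hq1 : ∀ x, ∑ y, q x y = 1) {γ : ℝ}
    (hγ : γ < ∑ x, ∑ y, p x * q x y * Real.log (densityRatio p q x y)) :
    ∃ s > 0, ∑ x, ∑ y, p x * q x y * Real.exp (s * (γ - Real.log (densityRatio p q x y))) < 1 := by
  set f : ℝ → ℝ := fun s =>
    ∑ x, ∑ y, p x * q x y * Real.exp (s * (γ - Real.log (densityRatio p q x y))) with hf
  have hpq : ∑ x, ∑ y, p x * q x y = 1 := by
    simp [← Finset.mul_sum, hq1, hp.2]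
  have hd : HasDerivAt f (∑ x, ∑ y, p x * q x y * (γ - Real.log (densityRatio p q x y))) 0 := by
    refine HasDerivAt.fun_sum fun x _ => HasDerivAt.fun_sum fun y _ => ?_
    have := (((hasDerivAt_id (0 : ℝ)).mul_const
      (γ - Real.log (densityRatio p q x y))).exp).const_mul (p x * q x y)
    simpa using this
  have hneg : ∑ x, ∑ y, p x * q x y * (γ - Real.log (densityRatio p q x y)) < 0 := by
    simp only [mul_sub, Finset.sum_sub_distrib, ← Finset.sum_mul, hpq]
    linarith
  have h0 : f 0 = 1 := by simp [hf, hpq]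
  have hev := hd.hasDerivWithinAt (s := Set.Ioi 0)
  rw [hasDerivWithinAt_iff_tendsto_slope' (by simp)] at hev
  obtain ⟨s, hs, hs0⟩ := ((hev.eventually_lt_const hneg).and self_mem_nhdsWithin).exists
  refine ⟨s, hs0, ?_⟩
  have hs0' : (0 : ℝ) < s := hs0
  rw [slope_def_field, sub_zero, h0, div_lt_iff₀ hs0', zero_mul] at hs
  exact sub_neg.1 hs

/-- Chernoff's bound: the indicator is at most exp(s(nγ − ∑ log density)), whose mean factorises
over positions. -/
theorem sum_low_density_le (hp : p ∈ stdSimplex ℝ X) (hq : ∀ x y, 0 ≤ q x y) (n : ℕ) (γ : ℝ)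
    {s : ℝ} (hs : 0 < s) :
    ∑ x : Fin n → X, (∏ i, p (x i)) * ∑ y : Fin n → Y, (∏ i, q (x i) (y i)) *
        (if ∏ i, densityRatio p q (x i) (y i) ≤ Real.exp (n * γ) then 1 else 0) ≤
      (∑ x, ∑ y, p x * q x y * Real.exp (s * (γ - Real.log (densityRatio p q x y)))) ^ n := by
  have hrhs : (∑ x, ∑ y, p x * q x y *
      Real.exp (s * (γ - Real.log (densityRatio p q x y)))) ^ n =
      ∑ x : Fin n → X, ∑ y : Fin n → Y, ∏ i, (p (x i) * q (x i) (y i) *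
        Real.exp (s * (γ - Real.log (densityRatio p q (x i) (y i))))) := by
    have h := sum_prod_apply (ι := Fin n) fun _ x => ∑ y, p x * q x y *
      Real.exp (s * (γ - Real.log (densityRatio p q x y)))
    rw [Finset.prod_const, Finset.card_univ, Fintype.card_fin] at h
    rw [← h]
    refine Finset.sum_congr rfl fun x _ => ?_
    rw [sum_prod_apply fun i y => p (x i) * q (x i) y *
      Real.exp (s * (γ - Real.log (densityRatio p q (x i) y)))]
  rw [hrhs]
  refine Finset.sum_le_sum fun x _ => ?_
  rw [Finset.mul_sum]
  refine Finset.sum_le_sum fun y _ => ?_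
  have hpq : ∀ i, 0 ≤ p (x i) * q (x i) (y i) := fun i => mul_nonneg (hp.1 _) (hq _ _)
  rw [← mul_assoc, ← Finset.prod_mul_distrib, Finset.prod_mul_distrib (f := fun i =>
    p (x i) * q (x i) (y i))]
  by_cases hpos : ∀ i, 0 < p (x i) * q (x i) (y i)
  · refine mul_le_mul_of_nonneg_left ?_ (Finset.prod_nonneg fun i _ => hpq i)
    rw [← Real.exp_sum, ← Finset.mul_sum, Finset.sum_sub_distrib]
    split_ifs with h
    · have hd : ∀ i, 0 < densityRatio p q (x i) (y i) := fun i => densityRatio_pos hp hq (hpos i)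
      have h1 := Real.log_le_log (Finset.prod_pos fun i _ => hd i) h
      rw [Real.log_exp, Real.log_prod fun i _ => (hd i).ne'] at h1
      refine Real.one_le_exp (mul_nonneg hs.le ?_)
      simp only [Finset.sum_const, Finset.card_univ, Fintype.card_fin, nsmul_eq_mul]
      linarith
    · positivity
  · push Not at hpos
    obtain ⟨i, hi⟩ := hpos
    rw [Finset.prod_eq_zero (Finset.mem_univ i) (le_antisymm hi (hpq i))]
    simp

/-- Markov's inequality: for a codeword independent of the output, the density ratio has mean at
most 1. -/
theorem sum_high_density_le (hp : p ∈ stdSimplex ℝ X) (hq : ∀ x y, 0 ≤ q x y)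
    (hq1 : ∀ x, ∑ y, q x y = 1) (n : ℕ) {θ : ℝ} (hθ : 0 < θ) :
    ∑ y : Fin n → Y, (∏ i, outputLaw p q (y i)) * ∑ x : Fin n → X, (∏ i, p (x i)) *
        (if θ < ∏ i, densityRatio p q (x i) (y i) then 1 else 0) ≤ 1 / θ := by
  have hr : ∀ y, 0 ≤ outputLaw p q y := outputLaw_nonneg hp hq
  have hterm : ∀ (x : Fin n → X) (y : Fin n → Y), (∏ i, outputLaw p q (y i)) * ((∏ i, p (x i)) *
        (if θ < ∏ i, densityRatio p q (x i) (y i) then 1 else 0)) ≤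
        (∏ i, p (x i)) * (∏ i, q (x i) (y i)) * (1 / θ) := by
    intro x y
    have h1 : (if θ < ∏ i, densityRatio p q (x i) (y i) then (1 : ℝ) else 0) ≤
        (∏ i, densityRatio p q (x i) (y i)) * (1 / θ) := by
      split_ifs with h
      · rw [mul_one_div, le_div_iff₀ hθ, one_mul]
        exact h.le
      · exact mul_nonneg (Finset.prod_nonneg fun i _ => densityRatio_nonneg hp hq _ _)
          (by positivity)
    have h2 : (∏ i, outputLaw p q (y i)) * ∏ i, densityRatio p q (x i) (y i) ≤
        ∏ i, q (x i) (y i) := by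
      rw [← Finset.prod_mul_distrib]
      exact Finset.prod_le_prod
        (fun i _ => mul_nonneg (hr _) (densityRatio_nonneg hp hq _ _))
        (fun i _ => outputLaw_mul_densityRatio_le hq _ _)
    have h3 : 0 ≤ ∏ i, p (x i) := Finset.prod_nonneg fun i _ => hp.1 _
    have h4 : 0 ≤ ∏ i, outputLaw p q (y i) := Finset.prod_nonneg fun i _ => hr _
    calc _ ≤ (∏ i, outputLaw p q (y i)) * ((∏ i, p (x i)) *
          ((∏ i, densityRatio p q (x i) (y i)) * (1 / θ))) := by gcongr
      _ = (∏ i, p (x i)) * ((∏ i, outputLaw p q (y i)) *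
          ∏ i, densityRatio p q (x i) (y i)) * (1 / θ) := by ring
      _ ≤ _ := by gcongr
  calc _ = ∑ y : Fin n → Y, ∑ x : Fin n → X, (∏ i, outputLaw p q (y i)) * ((∏ i, p (x i)) *
        (if θ < ∏ i, densityRatio p q (x i) (y i) then 1 else 0)) := by
        simp only [Finset.mul_sum]
    _ ≤ ∑ y : Fin n → Y, ∑ x : Fin n → X, (∏ i, p (x i)) * (∏ i, q (x i) (y i)) * (1 / θ) :=
        Finset.sum_le_sum fun y _ => Finset.sum_le_sum fun x _ => hterm x y
    _ = 1 / θ := by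
        rw [Finset.sum_comm]
        simp only [← Finset.sum_mul, ← Finset.mul_sum]
        have hq' : ∀ x : Fin n → X, ∑ y : Fin n → Y, ∏ i, q (x i) (y i) = 1 := fun x => by
          rw [sum_prod_apply fun i y => q (x i) y]; simp [hq1]
        have hp' : ∑ x : Fin n → X, ∏ i, p (x i) = 1 := by
          rw [sum_prod_apply fun _ x => p x]; simp [hp.2]
        simp [hq', hp']

/-- The weight of a random codebook with independent letters of law `p`. -/
def codebookLaw (p : X → ℝ) {n M : ℕ} (e : Fin M → Fin n → X) : ℝ := ∏ w, ∏ i, p (e w i)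

theorem sum_prod_law (hp : p ∈ stdSimplex ℝ X) (n : ℕ) :
    ∑ x : Fin n → X, ∏ i, p (x i) = 1 := by
  rw [sum_prod_apply fun _ x => p x]; simp [hp.2]

theorem codebookLaw_nonneg (hp : p ∈ stdSimplex ℝ X) {n M : ℕ} (e : Fin M → Fin n → X) :
    0 ≤ codebookLaw p e :=
  Finset.prod_nonneg fun _ _ => Finset.prod_nonneg fun _ _ => hp.1 _

theorem sum_codebookLaw (hp : p ∈ stdSimplex ℝ X) (n M : ℕ) :
    ∑ e : Fin M → Fin n → X, codebookLaw p e = 1 := by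
  unfold codebookLaw
  rw [sum_prod_apply fun _ (x : Fin n → X) => ∏ i, p (x i)]
  simp [sum_prod_law hp]

theorem sum_codebookLaw_mul_apply (hp : p ∈ stdSimplex ℝ X) {n M : ℕ} (w : Fin M)
    (F : (Fin n → X) → ℝ) :
    ∑ e : Fin M → Fin n → X, codebookLaw p e * F (e w) =
      ∑ x : Fin n → X, (∏ i, p (x i)) * F x :=
  sum_prod_mul_apply (fun _ (x : Fin n → X) => ∏ i, p (x i)) (fun _ => sum_prod_law hp n) w F

/-- The random coding bound for the threshold decoder. -/
theorem sum_codebookLaw_mul_error_le (hp : p ∈ stdSimplex ℝ X) (hq : ∀ x y, 0 ≤ q x y)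
    (hq1 : ∀ x, ∑ y, q x y = 1) {n M : ℕ} (hM : 0 < M) (γ : ℝ) {s : ℝ} (hs : 0 < s) (w : Fin M) :
    ∑ e : Fin M → Fin n → X, codebookLaw p e * ∑ y : Fin n → Y,
        (if thresholdDecoder hM p q (Real.exp (n * γ)) e y ≠ w then ∏ i, q (e w i) (y i) else 0) ≤
      (∑ x, ∑ y, p x * q x y * Real.exp (s * (γ - Real.log (densityRatio p q x y)))) ^ n +
        (M - 1) * (1 / Real.exp (n * γ)) := by
  set θ := Real.exp (n * γ) with hθ
  have hθ0 : 0 < θ := Real.exp_pos _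
  -- Distinct codewords are independent: averaging over codeword `w` turns the output into an i.i.d.
  -- sequence of law `outputLaw p q`, independent of codeword `w'`.
  have hcross : ∀ w' ∈ Finset.univ.erase w, ∑ e : Fin M → Fin n → X, codebookLaw p e *
      ∑ y : Fin n → Y, (∏ i, q (e w i) (y i)) *
        (if θ < ∏ i, densityRatio p q (e w' i) (y i) then 1 else 0) ≤ 1 / θ := by
    intro w' hw'
    refine le_trans (le_of_eq ?_) (sum_high_density_le hp hq hq1 n hθ0)
    simp_rw [Finset.mul_sum (s := (Finset.univ : Finset (Fin n → Y)))]
    rw [Finset.sum_comm]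
    refine Finset.sum_congr rfl fun y _ => ?_
    refine (sum_prod_mul_apply_mul_apply (fun _ (x : Fin n → X) => ∏ i, p (x i))
      (fun _ => sum_prod_law hp n) (Finset.ne_of_mem_erase hw').symm
      (fun x => ∏ i, q (x i) (y i))
      (fun x => if θ < ∏ i, densityRatio p q (x i) (y i) then 1 else 0)).trans ?_
    congr 1
    simp_rw [← Finset.prod_mul_distrib]
    rw [sum_prod_apply fun i x => p x * q x (y i)]
    rfl
  calc _ ≤ ∑ e : Fin M → Fin n → X, codebookLaw p e * ∑ y : Fin n → Y,
        ((∏ i, q (e w i) (y i)) *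
          (if ∏ i, densityRatio p q (e w i) (y i) ≤ θ then 1 else 0) +
        ∑ w' ∈ Finset.univ.erase w, (∏ i, q (e w i) (y i)) *
          (if θ < ∏ i, densityRatio p q (e w' i) (y i) then 1 else 0)) :=
        Finset.sum_le_sum fun e _ => mul_le_mul_of_nonneg_left
          (Finset.sum_le_sum fun y _ => ite_thresholdDecoder_le hM p q θ e y w
            (Finset.prod_nonneg fun i _ => hq _ _)) (codebookLaw_nonneg hp e)
    _ = ∑ e : Fin M → Fin n → X, codebookLaw p e * ∑ y : Fin n → Y, (∏ i, q (e w i) (y i)) *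
          (if ∏ i, densityRatio p q (e w i) (y i) ≤ θ then 1 else 0) +
        ∑ w' ∈ Finset.univ.erase w, ∑ e : Fin M → Fin n → X, codebookLaw p e *
          ∑ y : Fin n → Y, (∏ i, q (e w i) (y i)) *
          (if θ < ∏ i, densityRatio p q (e w' i) (y i) then 1 else 0) := by
        rw [Finset.sum_comm (s := Finset.univ.erase w), ← Finset.sum_add_distrib]
        refine Finset.sum_congr rfl fun e _ => ?_
        rw [Finset.sum_add_distrib, mul_add, ← Finset.mul_sum]
        congr 2
        exact Finset.sum_comm
    _ ≤ (∑ x, ∑ y, p x * q x y *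
          Real.exp (s * (γ - Real.log (densityRatio p q x y)))) ^ n + ∑ w' ∈ Finset.univ.erase w, 1 / θ := by
        refine add_le_add ?_ (Finset.sum_le_sum hcross)
        rw [sum_codebookLaw_mul_apply hp w fun x => ∑ y : Fin n → Y, (∏ i, q (x i) (y i)) *
          (if ∏ i, densityRatio p q (x i) (y i) ≤ θ then 1 else 0)]
        exact sum_low_density_le hp hq n γ hs
    _ = _ := by
        rw [Finset.sum_const, Finset.card_erase_of_mem (Finset.mem_univ w), Finset.card_univ,
          Fintype.card_fin, nsmul_eq_mul, Nat.cast_sub hM, Nat.cast_one]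

/-- Random coding at rates below the mutual information (or at rate `0`). -/
theorem exists_decoders (hp : p ∈ stdSimplex ℝ X) (hq : ∀ x y, 0 ≤ q x y)
    (hq1 : ∀ x, ∑ y, q x y = 1) {R : ℝ}
    (hR : R = 0 ∨ R < mutualInfo fun x y => p x * q x y) :
    ∃ δ : ℕ → ℝ, Filter.Tendsto δ Filter.atTop (nhds 0) ∧
      ∀ n : ℕ, ∃ D : (Fin ⌈(2 : ℝ) ^ ((n : ℝ) * R)⌉₊ → Fin n → X) → (Fin n → Y) →
          Fin ⌈(2 : ℝ) ^ ((n : ℝ) * R)⌉₊,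
        ∀ w, ∑ e, codebookLaw p e * ∑ y : Fin n → Y,
          (if D e y ≠ w then ∏ i, q (e w i) (y i) else 0) ≤ δ n := by
  have hl2 : 0 < Real.log 2 := Real.log_pos one_lt_two
  set J := ∑ x, ∑ y, p x * q x y * Real.log (densityRatio p q x y) with hJ
  -- The threshold exponent lies strictly between rate and information, in nats. At rate 0 there is
  -- only one message, so no lower constraint is needed; this covers channels with zero information.
  obtain ⟨γ, hγJ, hγR⟩ : ∃ γ < J, R = 0 ∨ R * Real.log 2 < γ := by
    rcases hR with h | h
    · exact ⟨J - 1, by linarith, Or.inl h⟩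
    · rw [mutualInfo_eq_sum_densityRatio hq1, lt_div_iff₀ hl2] at h
      obtain ⟨γ, h1, h2⟩ := exists_between h
      exact ⟨γ, h2, Or.inr h1⟩
  obtain ⟨s, hs, hs1⟩ := exists_exp_moment_lt_one hp hq1 hγJ
  set φ := ∑ x, ∑ y, p x * q x y * Real.exp (s * (γ - Real.log (densityRatio p q x y))) with hφ
  have hφ0 : 0 ≤ φ := Finset.sum_nonneg fun x _ => Finset.sum_nonneg fun y _ =>
    mul_nonneg (mul_nonneg (hp.1 x) (hq x y)) (Real.exp_pos _).le
  have hM : ∀ n : ℕ, 0 < ⌈(2 : ℝ) ^ ((n : ℝ) * R)⌉₊ := fun n =>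
    Nat.ceil_pos.2 (Real.rpow_pos_of_pos two_pos _)
  refine ⟨fun n => φ ^ n + (⌈(2 : ℝ) ^ ((n : ℝ) * R)⌉₊ - 1) * (1 / Real.exp (n * γ)), ?_,
    fun n => ⟨thresholdDecoder (hM n) p q (Real.exp (n * γ)), fun w =>
      sum_codebookLaw_mul_error_le hp hq hq1 (hM n) γ hs w⟩⟩
  rw [← add_zero (0 : ℝ)]
  refine (tendsto_pow_atTop_nhds_zero_of_lt_one hφ0 hs1).add ?_
  rcases hγR with h | h
  · simp [h]
  · have hlt : Real.exp (R * Real.log 2 - γ) < 1 := Real.exp_lt_one_iff.2 (by linarith)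
    refine squeeze_zero (fun n => ?_) (fun n => ?_)
      (tendsto_pow_atTop_nhds_zero_of_lt_one (Real.exp_pos _).le hlt)
    · have : (1 : ℝ) ≤ ⌈(2 : ℝ) ^ ((n : ℝ) * R)⌉₊ := by exact_mod_cast hM n
      exact mul_nonneg (by linarith) (by positivity)
    · have h1 := (Nat.ceil_lt_add_one (Real.rpow_pos_of_pos two_pos ((n : ℝ) * R)).le).le
      calc _ ≤ (2 : ℝ) ^ ((n : ℝ) * R) * (1 / Real.exp (n * γ)) := by
            gcongr
            linarith
        _ = _ := by
            rw [Real.rpow_def_of_pos two_pos, ← Real.exp_nat_mul, mul_one_div, ← Real.exp_sub]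
            ring_nf

end PointToPoint

/-! ### Averaging over two codebooks -/

section RandomCodes

variable {X Y Z : Type*} [Fintype X] [Fintype Y] [Fintype Z]

/-- The decoder `D` does not see the interferer's codebook, so averaging over that codebook replaces
the channel by its mean over i.i.d. interference. -/
theorem sum_codebookLaw_mul_sum_codebookLaw_mul {r : Z → ℝ} (hr : r ∈ stdSimplex ℝ Z)
    (p : X → ℝ) (m : X → Z → Y → ℝ) {n M N : ℕ}
    (D : (Fin M → Fin n → X) → (Fin n → Y) → Fin M) (w : Fin M) (v : Fin N) :
    ∑ e : Fin M → Fin n → X, codebookLaw p e * ∑ f : Fin N → Fin n → Z, codebookLaw r f *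
        ∑ y : Fin n → Y, (if D e y ≠ w then ∏ i, m (e w i) (f v i) (y i) else 0) =
      ∑ e : Fin M → Fin n → X, codebookLaw p e *
        ∑ y : Fin n → Y, (if D e y ≠ w then ∏ i, ∑ z, r z * m (e w i) z (y i) else 0) := by
  refine Finset.sum_congr rfl fun e _ => ?_
  congr 1
  rw [sum_codebookLaw_mul_apply hr v fun z => ∑ y : Fin n → Y,
    (if D e y ≠ w then ∏ i, m (e w i) (z i) (y i) else 0)]
  simp_rw [Finset.mul_sum]
  rw [Finset.sum_comm]
  refine Finset.sum_congr rfl fun y _ => ?_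
  split_ifs
  · simp_rw [← Finset.prod_mul_distrib]
    rw [sum_prod_apply fun i z => r z * m (e w i) z (y i)]
  · simp

theorem sum_mul_average {A B C D : Type*} [Fintype A] [Fintype B] [Fintype C] [Fintype D]
    (a : A → ℝ) (b : B → ℝ) (k : ℝ) (G : A → B → C → D → ℝ) :
    ∑ e, ∑ f, a e * b f * (k * ∑ w, ∑ v, G e f w v) =
      k * ∑ w, ∑ v, ∑ e, a e * ∑ f, b f * G e f w v := by
  simp only [Finset.mul_sum]
  calc _ = ∑ e, ∑ w, ∑ f, ∑ v, a e * b f * (k * G e f w v) :=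
        Finset.sum_congr rfl fun e _ => Finset.sum_comm
    _ = ∑ w, ∑ e, ∑ f, ∑ v, a e * b f * (k * G e f w v) := Finset.sum_comm
    _ = ∑ w, ∑ e, ∑ v, ∑ f, a e * b f * (k * G e f w v) :=
        Finset.sum_congr rfl fun w _ => Finset.sum_congr rfl fun e _ => Finset.sum_comm
    _ = ∑ w, ∑ v, ∑ e, ∑ f, a e * b f * (k * G e f w v) :=
        Finset.sum_congr rfl fun w _ => Finset.sum_comm
    _ = _ := by
        refine Finset.sum_congr rfl fun w _ => Finset.sum_congr rfl fun v _ =>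
          Finset.sum_congr rfl fun e _ => Finset.sum_congr rfl fun f _ => ?_
        ring

theorem exists_le_of_sum_mul_le {Ω : Type*} [Fintype Ω] {Q E : Ω → ℝ} {δ : ℝ}
    (hQ : ∀ ω, 0 ≤ Q ω) (hQ1 : ∑ ω, Q ω = 1) (h : ∑ ω, Q ω * E ω ≤ δ) : ∃ ω, E ω ≤ δ := by
  by_contra! hlt
  obtain ⟨ω, hω⟩ : ∃ ω, 0 < Q ω := by
    by_contra! hn
    have := Finset.sum_nonpos fun ω (_ : ω ∈ Finset.univ) => hn ω
    linarith
  have hpos : 0 < ∑ ω, Q ω * (E ω - δ) :=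
    Finset.sum_pos' (fun ω _ => mul_nonneg (hQ ω) (sub_nonneg.2 (hlt ω).le))
      ⟨ω, Finset.mem_univ ω, mul_pos hω (sub_pos.2 (hlt ω))⟩
  simp only [mul_sub, Finset.sum_sub_distrib, ← Finset.sum_mul, hQ1] at hpos
  linarith

end RandomCodes

/-! ### Nonnegativity and continuity of mutual information -/

section MutualInfo

variable {α β : Type*} [Fintype α] [Fintype β]

theorem mutualInfo_nonneg {p : α → β → ℝ} (hp : ∀ a b, 0 ≤ p a b) (hp1 : ∑ a, ∑ b, p a b = 1) :
    0 ≤ mutualInfo p := by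
  set μ : α × β → ℝ := fun x => p x.1 x.2 with hμ
  have hμ0 : ∀ x, 0 ≤ μ x := fun x => hp _ _
  have hμ1 : ∑ x, μ x = 1 := by rw [Fintype.sum_prod_type]; exact hp1
  have hA : ∀ x, 0 < μ x → 0 < ∑ b, p x.1 b := fun x hx =>
    Finset.sum_pos' (fun b _ => hp _ _) ⟨x.2, Finset.mem_univ _, hx⟩
  have hB : ∀ x, 0 < μ x → 0 < ∑ a, p a x.2 := fun x hx =>
    Finset.sum_pos' (fun b _ => hp _ _) ⟨x.1, Finset.mem_univ _, hx⟩
  have hprod : ∑ x : α × β, (∑ b, p x.1 b) * ∑ a, p a x.2 = 1 := by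
    rw [Fintype.sum_prod_type]
    simp only [← Finset.mul_sum]
    rw [← Finset.sum_mul, hp1, Finset.sum_comm, hp1, one_mul]
  have key := sum_mul_log_nonpos (r := fun x => ((∑ b, p x.1 b) * ∑ a, p a x.2) / μ x) hμ0
    (fun x hx => div_pos (mul_pos (hA x hx) (hB x hx)) hx) (by
      rw [hμ1, ← hprod]
      refine Finset.sum_le_sum fun x _ => ?_
      rcases (hμ0 x).eq_or_lt with h | h
      · rw [← h, zero_mul]
        exact mul_nonneg (Finset.sum_nonneg fun b _ => hp _ _) (Finset.sum_nonneg fun a _ => hp _ _)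
      · exact (mul_div_cancel₀ _ h.ne').le)
  have heq : mutualInfo p =
      (- ∑ x, μ x * Real.log (((∑ b, p x.1 b) * ∑ a, p a x.2) / μ x)) / Real.log 2 := by
    unfold mutualInfo
    rw [Fintype.sum_prod_type, ← Finset.sum_neg_distrib, Finset.sum_div]
    refine Finset.sum_congr rfl fun a _ => ?_
    rw [← Finset.sum_neg_distrib, Finset.sum_div]
    refine Finset.sum_congr rfl fun b _ => ?_
    rw [← mul_neg, ← Real.log_inv, inv_div, Real.logb, mul_div_assoc]
  rw [heq]
  exact div_nonneg (neg_nonneg.2 key) (Real.log_pos one_lt_two).le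

/-- Removes the quotient, which is singular at zero masses: `Real.negMulLog` is continuous
everywhere, so continuity up to the boundary of the simplex follows. -/
theorem mutualInfo_eq_entropies {p : α → β → ℝ} (hp : ∀ a b, 0 ≤ p a b) :
    mutualInfo p = (∑ a, Real.negMulLog (∑ b, p a b) + ∑ b, Real.negMulLog (∑ a, p a b) -
      ∑ a, ∑ b, Real.negMulLog (p a b)) / Real.log 2 := by
  have hterm : ∀ a b, p a b * Real.logb 2 (p a b / ((∑ b', p a b') * ∑ a', p a' b)) =
      (-(p a b * Real.log (∑ b', p a b')) - p a b * Real.log (∑ a', p a' b) -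
        Real.negMulLog (p a b)) / Real.log 2 := by
    intro a b
    rcases (hp a b).eq_or_lt with h | h
    · simp [← h]
    have h1 : 0 < ∑ b', p a b' := Finset.sum_pos' (fun b _ => hp _ _) ⟨b, Finset.mem_univ _, h⟩
    have h2 : 0 < ∑ a', p a' b := Finset.sum_pos' (fun b _ => hp _ _) ⟨a, Finset.mem_univ _, h⟩
    rw [Real.logb, Real.log_div h.ne' (mul_pos h1 h2).ne', Real.log_mul h1.ne' h2.ne',
      Real.negMulLog]
    ring
  unfold mutualInfo
  simp only [hterm, ← Finset.sum_div, Finset.sum_sub_distrib, Finset.sum_neg_distrib]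
  rw [Finset.sum_comm (f := fun a b => p a b * Real.log (∑ a', p a' b))]
  simp only [← Finset.sum_mul, Real.negMulLog, neg_mul, Finset.sum_neg_distrib]
  ring

theorem continuousOn_mutualInfo {T : Type*} [TopologicalSpace T] {p : T → α → β → ℝ} {s : Set T}
    (hp : ∀ t ∈ s, ∀ a b, 0 ≤ p t a b) (hc : ∀ a b, Continuous fun t => p t a b) :
    ContinuousOn (fun t => mutualInfo (p t)) s := by
  refine ContinuousOn.congr (f := fun t => (∑ a, Real.negMulLog (∑ b, p t a b) +
    ∑ b, Real.negMulLog (∑ a, p t a b) - ∑ a, ∑ b, Real.negMulLog (p t a b)) / Real.log 2) ?_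
    fun t ht => mutualInfo_eq_entropies (hp t ht)
  refine Continuous.continuousOn (Continuous.div_const ?_ _)
  refine ((continuous_finsetSum _ fun a _ => Real.continuous_negMulLog.comp
    (continuous_finsetSum _ fun b _ => hc a b)).add (continuous_finsetSum _ fun b _ =>
      Real.continuous_negMulLog.comp (continuous_finsetSum _ fun a _ => hc a b))).sub
    (continuous_finsetSum _ fun a _ => continuous_finsetSum _ fun b _ =>
      Real.continuous_negMulLog.comp (hc a b))

end MutualInfo

/-! ### Achievability -/

namespace DMIC

variable {X₁ X₂ Y₁ Y₂ : Type*} [Fintype Y₁] [Fintype Y₂]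

theorem err₁_eq (W : DMIC X₁ X₂ Y₁ Y₂) {n M₁ M₂ : ℕ} (c : ICCode X₁ X₂ Y₁ Y₂ n M₁ M₂) :
    W.err₁ c = 1 / ((M₁ : ℝ) * M₂) * ∑ w₁, ∑ w₂, ∑ y : Fin n → Y₁,
      if c.dec₁ y ≠ w₁ then ∏ i, W.marg₁ (c.enc₁ w₁ i) (c.enc₂ w₂ i) (y i) else 0 := by
  unfold err₁
  congr 1
  refine Finset.sum_congr rfl fun w₁ _ => Finset.sum_congr rfl fun w₂ _ =>
    Finset.sum_congr rfl fun y _ => ?_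
  split_ifs
  · exact sum_prod_apply fun i y₂ => W.prob (c.enc₁ w₁ i) (c.enc₂ w₂ i) (y i) y₂
  · simp

theorem err₂_eq (W : DMIC X₁ X₂ Y₁ Y₂) {n M₁ M₂ : ℕ} (c : ICCode X₁ X₂ Y₁ Y₂ n M₁ M₂) :
    W.err₂ c = 1 / ((M₁ : ℝ) * M₂) * ∑ w₁, ∑ w₂, ∑ y : Fin n → Y₂,
      if c.dec₂ y ≠ w₂ then ∏ i, W.marg₂ (c.enc₁ w₁ i) (c.enc₂ w₂ i) (y i) else 0 := by
  unfold err₂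
  congr 1
  refine Finset.sum_congr rfl fun w₁ _ => Finset.sum_congr rfl fun w₂ _ => ?_
  rw [Finset.sum_comm]
  refine Finset.sum_congr rfl fun y _ => ?_
  split_ifs
  · exact sum_prod_apply fun i y₁ => W.prob (c.enc₁ w₁ i) (c.enc₂ w₂ i) y₁ (y i)
  · simp

variable [Fintype X₁] [Fintype X₂]

theorem average_const_le {M₁ M₂ : ℕ} (hM₁ : 0 < M₁) (hM₂ : 0 < M₂) {F : Fin M₁ → Fin M₂ → ℝ}
    {δ : ℝ} (hF : ∀ w v, F w v ≤ δ) :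
    1 / ((M₁ : ℝ) * M₂) * ∑ w, ∑ v, F w v ≤ δ := by
  have h : ∑ w, ∑ v, F w v ≤ ∑ _w : Fin M₁, ∑ _v : Fin M₂, δ :=
    Finset.sum_le_sum fun w _ => Finset.sum_le_sum fun v _ => hF w v
  have h1 : (0 : ℝ) < M₁ := by exact_mod_cast hM₁
  have h2 : (0 : ℝ) < M₂ := by exact_mod_cast hM₂
  rw [one_div, inv_mul_le_iff₀ (by positivity)]
  simpa [mul_assoc] using h

/-- Treating interference as noise achieves all rate pairs below the mutual informations. -/
theorem achievable_of_lt_info (W : DMIC X₁ X₂ Y₁ Y₂) {p₁ : X₁ → ℝ} {p₂ : X₂ → ℝ}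
    (hp₁ : p₁ ∈ stdSimplex ℝ X₁) (hp₂ : p₂ ∈ stdSimplex ℝ X₂) {R₁ R₂ : ℝ}
    (hR₁ : 0 ≤ R₁) (hR₂ : 0 ≤ R₂) (h₁ : R₁ = 0 ∨ R₁ < W.info₁ p₁ p₂)
    (h₂ : R₂ = 0 ∨ R₂ < W.info₂ p₁ p₂) : W.Achievable R₁ R₂ := by
  set q₁ : X₁ → Y₁ → ℝ := fun x y => ∑ z, p₂ z * W.marg₁ x z y with hq₁
  set q₂ : X₂ → Y₂ → ℝ := fun x y => ∑ z, p₁ z * W.marg₂ z x y with hq₂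
  have hi₁ : W.info₁ p₁ p₂ = mutualInfo fun x y => p₁ x * q₁ x y := by
    simp only [info₁, hq₁, Finset.mul_sum, mul_assoc]
  have hi₂ : W.info₂ p₁ p₂ = mutualInfo fun x y => p₂ x * q₂ x y := by
    simp only [info₂, hq₂, Finset.mul_sum, mul_assoc, mul_left_comm (p₁ _)]
  have hq₁0 : ∀ x y, 0 ≤ q₁ x y := fun x y =>
    Finset.sum_nonneg fun z _ => mul_nonneg (hp₂.1 z) (W.marg₁_nonneg _ _ _)
  have hq₂0 : ∀ x y, 0 ≤ q₂ x y := fun x y =>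
    Finset.sum_nonneg fun z _ => mul_nonneg (hp₁.1 z) (W.marg₂_nonneg _ _ _)
  have hq₁1 : ∀ x, ∑ y, q₁ x y = 1 := fun x => by
    simp only [hq₁]
    rw [Finset.sum_comm]
    simp [← Finset.mul_sum, sum_marg₁, hp₂.2]
  have hq₂1 : ∀ x, ∑ y, q₂ x y = 1 := fun x => by
    simp only [hq₂]
    rw [Finset.sum_comm]
    simp [← Finset.mul_sum, sum_marg₂, hp₁.2]
  rw [hi₁] at h₁
  rw [hi₂] at h₂
  obtain ⟨δ₁, hδ₁, hD₁⟩ := exists_decoders hp₁ hq₁0 hq₁1 h₁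
  obtain ⟨δ₂, hδ₂, hD₂⟩ := exists_decoders hp₂ hq₂0 hq₂1 h₂
  choose D₁ hD₁ using hD₁
  choose D₂ hD₂ using hD₂
  have hM : ∀ (n : ℕ) (R : ℝ), 0 < ⌈(2 : ℝ) ^ ((n : ℝ) * R)⌉₊ := fun n R =>
    Nat.ceil_pos.2 (Real.rpow_pos_of_pos two_pos _)
  -- Bounding the sum of the errors yields a single code good for both receivers, as both errors are
  -- nonnegative.
  have hcode : ∀ n : ℕ, ∃ c : ICCode X₁ X₂ Y₁ Y₂ n ⌈(2 : ℝ) ^ ((n : ℝ) * R₁)⌉₊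
      ⌈(2 : ℝ) ^ ((n : ℝ) * R₂)⌉₊, W.err₁ c + W.err₂ c ≤ δ₁ n + δ₂ n := by
    intro n
    specialize hD₁ n
    specialize hD₂ n
    generalize D₁ n = D₁ at hD₁
    generalize D₂ n = D₂ at hD₂
    have hM₁ := hM n R₁
    have hM₂ := hM n R₂
    generalize ⌈(2 : ℝ) ^ ((n : ℝ) * R₁)⌉₊ = M₁ at *
    generalize ⌈(2 : ℝ) ^ ((n : ℝ) * R₂)⌉₊ = M₂ at *
    let code : (Fin M₁ → Fin n → X₁) × (Fin M₂ → Fin n → X₂) → ICCode X₁ X₂ Y₁ Y₂ n M₁ M₂ :=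
      fun x => ⟨x.1, x.2, D₁ x.1, D₂ x.2⟩
    obtain ⟨x, hx⟩ := exists_le_of_sum_mul_le
      (Q := fun x : (Fin M₁ → Fin n → X₁) × (Fin M₂ → Fin n → X₂) =>
        codebookLaw p₁ x.1 * codebookLaw p₂ x.2)
      (E := fun x => W.err₁ (code x) + W.err₂ (code x)) (δ := δ₁ n + δ₂ n)
      (fun x => mul_nonneg (codebookLaw_nonneg hp₁ _) (codebookLaw_nonneg hp₂ _))
      (by
        rw [Fintype.sum_prod_type]
        simp [← Finset.mul_sum, sum_codebookLaw hp₁, sum_codebookLaw hp₂])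
      (by
        simp only [mul_add, Finset.sum_add_distrib]
        refine add_le_add ?_ ?_
        · have h : ∑ x : (Fin M₁ → Fin n → X₁) × (Fin M₂ → Fin n → X₂),
              codebookLaw p₁ x.1 * codebookLaw p₂ x.2 * W.err₁ (code x) =
              1 / ((M₁ : ℝ) * M₂) * ∑ w, ∑ v : Fin M₂, ∑ e : Fin M₁ → Fin n → X₁,
                codebookLaw p₁ e * ∑ f : Fin M₂ → Fin n → X₂, codebookLaw p₂ f *
                ∑ y : Fin n → Y₁,
                  (if D₁ e y ≠ w then ∏ i, W.marg₁ (e w i) (f v i) (y i) else 0) := by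
            simp only [Fintype.sum_prod_type, err₁_eq]
            exact sum_mul_average _ _ _ fun e (f : Fin M₂ → Fin n → X₂) w v => ∑ y : Fin n → Y₁,
              (if D₁ e y ≠ w then ∏ i, W.marg₁ (e w i) (f v i) (y i) else 0)
          rw [h]
          refine average_const_le hM₁ hM₂ fun w v => ?_
          rw [sum_codebookLaw_mul_sum_codebookLaw_mul hp₂ p₁ W.marg₁ D₁ w v]
          exact hD₁ w
        · have h : ∑ x : (Fin M₁ → Fin n → X₁) × (Fin M₂ → Fin n → X₂),
              codebookLaw p₁ x.1 * codebookLaw p₂ x.2 * W.err₂ (code x) =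
              1 / ((M₁ : ℝ) * M₂) * ∑ w : Fin M₁, ∑ v, ∑ f : Fin M₂ → Fin n → X₂,
                codebookLaw p₂ f * ∑ e : Fin M₁ → Fin n → X₁, codebookLaw p₁ e *
                ∑ y : Fin n → Y₂,
                  (if D₂ f y ≠ v then ∏ i, W.marg₂ (e w i) (f v i) (y i) else 0) := by
            simp only [Fintype.sum_prod_type, err₂_eq]
            rw [Finset.sum_comm]
            simp only [mul_comm (codebookLaw p₁ _) (codebookLaw p₂ _)]
            exact sum_mul_average _ _ _ fun f (e : Fin M₁ → Fin n → X₁) w v => ∑ y : Fin n → Y₂,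
              (if D₂ f y ≠ v then ∏ i, W.marg₂ (e w i) (f v i) (y i) else 0)
          rw [h]
          refine average_const_le hM₁ hM₂ fun w v => ?_
          rw [sum_codebookLaw_mul_sum_codebookLaw_mul hp₁ p₂ (fun x z => W.marg₂ z x) D₂ v w]
          exact hD₂ v)
    exact ⟨code x, hx⟩
  choose c hc using hcode
  have hδ : Filter.Tendsto (fun n => δ₁ n + δ₂ n) Filter.atTop (nhds 0) := by
    simpa using hδ₁.add hδ₂
  refine ⟨hR₁, hR₂, c, squeeze_zero (fun n => W.err₁_nonneg _) (fun n => ?_) hδ,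
    squeeze_zero (fun n => W.err₂_nonneg _) (fun n => ?_) hδ⟩
  · linarith [hc n, W.err₂_nonneg (c n)]
  · linarith [hc n, W.err₁_nonneg (c n)]

theorem info₁_nonneg (W : DMIC X₁ X₂ Y₁ Y₂) {p₁ : X₁ → ℝ} {p₂ : X₂ → ℝ}
    (hp₁ : p₁ ∈ stdSimplex ℝ X₁) (hp₂ : p₂ ∈ stdSimplex ℝ X₂) : 0 ≤ W.info₁ p₁ p₂ := by
  refine mutualInfo_nonneg (fun x y => Finset.sum_nonneg fun z _ =>
    mul_nonneg (mul_nonneg (hp₁.1 _) (hp₂.1 _)) (W.marg₁_nonneg _ _ _)) ?_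
  have h : ∀ x, ∑ y, ∑ z, p₁ x * p₂ z * W.marg₁ x z y = p₁ x := fun x => by
    rw [Finset.sum_comm]
    simp [← Finset.mul_sum, sum_marg₁, hp₂.2]
  simp [h, hp₁.2]

theorem info₂_nonneg (W : DMIC X₁ X₂ Y₁ Y₂) {p₁ : X₁ → ℝ} {p₂ : X₂ → ℝ}
    (hp₁ : p₁ ∈ stdSimplex ℝ X₁) (hp₂ : p₂ ∈ stdSimplex ℝ X₂) : 0 ≤ W.info₂ p₁ p₂ := by
  refine mutualInfo_nonneg (fun x y => Finset.sum_nonneg fun z _ =>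
    mul_nonneg (mul_nonneg (hp₁.1 _) (hp₂.1 _)) (W.marg₂_nonneg _ _ _)) ?_
  have h : ∀ x, ∑ y, ∑ z, p₁ z * p₂ x * W.marg₂ z x y = p₂ x := fun x => by
    rw [Finset.sum_comm]
    simp [← Finset.mul_sum, sum_marg₂, ← Finset.sum_mul, hp₁.2]
  simp [h, hp₂.2]

/-- Approached by the pairs scaled by t < 1. A zero coordinate stays 0 instead of becoming strictly
smaller, which is why achievability allows rate 0 separately. -/
theorem info_mem_capacityRegion (W : DMIC X₁ X₂ Y₁ Y₂) {p₁ : X₁ → ℝ} {p₂ : X₂ → ℝ}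
    (hp₁ : p₁ ∈ stdSimplex ℝ X₁) (hp₂ : p₂ ∈ stdSimplex ℝ X₂) :
    (W.info₁ p₁ p₂, W.info₂ p₁ p₂) ∈ W.capacityRegion := by
  have hI₁ := W.info₁_nonneg hp₁ hp₂
  have hI₂ := W.info₂_nonneg hp₁ hp₂
  have hlim : Filter.Tendsto (fun t : ℝ => (t * W.info₁ p₁ p₂, t * W.info₂ p₁ p₂))
      (nhdsWithin 1 (Set.Iio 1)) (nhds (W.info₁ p₁ p₂, W.info₂ p₁ p₂)) := by
    have hc : Continuous fun t : ℝ => (t * W.info₁ p₁ p₂, t * W.info₂ p₁ p₂) := by fun_prop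
    have := (hc.tendsto 1).mono_left (nhdsWithin_le_nhds (s := Set.Iio 1))
    simpa using this
  refine mem_closure_of_tendsto hlim ?_
  filter_upwards [Ioo_mem_nhdsLT (zero_lt_one (α := ℝ))] with t ht
  have hcase : ∀ {I : ℝ}, 0 ≤ I → t * I = 0 ∨ t * I < I := fun {I} hI => by
    rcases hI.eq_or_lt with h | h
    · exact Or.inl (by rw [← h, mul_zero])
    · exact Or.inr (mul_lt_of_lt_one_left h ht.2)
  exact W.achievable_of_lt_info hp₁ hp₂ (mul_nonneg ht.1.le hI₁) (mul_nonneg ht.1.le hI₂)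
    (hcase hI₁) (hcase hI₂)

theorem continuousOn_info_add_info (W : DMIC X₁ X₂ Y₁ Y₂) :
    ContinuousOn (fun p : (X₁ → ℝ) × (X₂ → ℝ) => W.info₁ p.1 p.2 + W.info₂ p.1 p.2)
      (stdSimplex ℝ X₁ ×ˢ stdSimplex ℝ X₂) := by
  refine ContinuousOn.add
    (continuousOn_mutualInfo (p := fun (p : (X₁ → ℝ) × (X₂ → ℝ)) x₁ y₁ =>
      ∑ x₂, p.1 x₁ * p.2 x₂ * W.marg₁ x₁ x₂ y₁)
      (fun p hp x y => Finset.sum_nonneg fun z _ =>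
        mul_nonneg (mul_nonneg (hp.1.1 _) (hp.2.1 _)) (W.marg₁_nonneg _ _ _))
      fun x y => by fun_prop)
    (continuousOn_mutualInfo (p := fun (p : (X₁ → ℝ) × (X₂ → ℝ)) x₂ y₂ =>
      ∑ x₁, p.1 x₁ * p.2 x₂ * W.marg₂ x₁ x₂ y₂)
      (fun p hp x y => Finset.sum_nonneg fun z _ =>
        mul_nonneg (mul_nonneg (hp.1.1 _) (hp.2.1 _)) (W.marg₂_nonneg _ _ _))
      fun x y => by fun_prop)

end DMIC

end

theorem theorem1 {X₁ X₂ Y₁ Y₂ : Type*} [Fintype X₁] [Fintype X₂] [Fintype Y₁] [Fintype Y₂]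
    [Nonempty X₁] [Nonempty X₂] (W : DMIC X₁ X₂ Y₁ Y₂) (hW : W.WeakOneSided) :
    IsGreatest W.sumRates W.sumCapacity ∧
    IsGreatest {s : ℝ | ∃ p₁ ∈ stdSimplex ℝ X₁, ∃ p₂ ∈ stdSimplex ℝ X₂,
      s = W.info₁ p₁ p₂ + W.info₂ p₁ p₂} W.sumCapacity := by
  classical
  have hne : (stdSimplex ℝ X₁ ×ˢ stdSimplex ℝ X₂).Nonempty :=
    ⟨(Pi.single (Classical.arbitrary X₁) 1, Pi.single (Classical.arbitrary X₂) 1),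
      single_mem_stdSimplex ℝ _, single_mem_stdSimplex ℝ _⟩
  obtain ⟨⟨p₁, p₂⟩, ⟨hp₁, hp₂⟩, hmax⟩ :=
    ((isCompact_stdSimplex ℝ X₁).prod (isCompact_stdSimplex ℝ X₂)).exists_isMaxOn hne
      W.continuousOn_info_add_info
  have hle : ∀ p₁' ∈ stdSimplex ℝ X₁, ∀ p₂' ∈ stdSimplex ℝ X₂,
      W.info₁ p₁' p₂' + W.info₂ p₁' p₂' ≤ W.info₁ p₁ p₂ + W.info₂ p₁ p₂ :=
    fun p₁' h₁ p₂' h₂ => isMaxOn_iff.1 hmax (p₁', p₂') (Set.mk_mem_prod h₁ h₂)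
  have hgreat : IsGreatest W.sumRates (W.info₁ p₁ p₂ + W.info₂ p₁ p₂) := by
    refine ⟨⟨_, W.info_mem_capacityRegion hp₁ hp₂, rfl⟩, ?_⟩
    rintro _ ⟨R, hR, rfl⟩
    -- The half-plane is closed, so the bound on achievable pairs extends to the capacity region.
    have hclosed : IsClosed {R : ℝ × ℝ | R.1 + R.2 ≤ W.info₁ p₁ p₂ + W.info₂ p₁ p₂} :=
      isClosed_le (by fun_prop) (by fun_prop)
    exact closure_minimal (fun R hR => hW.add_le_of_achievable hle hR) hclosed hR
  have heq : W.sumCapacity = W.info₁ p₁ p₂ + W.info₂ p₁ p₂ := hgreat.csSup_eq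
  rw [heq]
  refine ⟨hgreat, ⟨p₁, hp₁, p₂, hp₂, rfl⟩, ?_⟩
  rintro _ ⟨p₁', h₁, p₂', h₂, rfl⟩
  exact hle p₁' h₁ p₂' h₂
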